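/- **Setting.** An instance of Directed Latency with Target consists of a set $V$ of $n$ clients, two further points $s,s'$, and an asymmetric metric $c$ on $V\cup\{s,s'\}$ ($c(u,u)=0$ and $c(u,w)\le c(u,v)+c(v,w)$, symmetry not required). A solution is an $s$-$s'$-path $P$ visiting every client exactly once; its total latency is $\ell(P)=\sum_{v\in V}c_P(v)$, where $c_P(v)$ is the length of the part of $P$ from $s$ to $v$. For $\epsilon>0$ the instance is *$\epsilon$-nice* if $n=2^k-1$ for an integer $k$ and, for all distinct $u,v\in V\cup\{s,s'\}$, $c(u,v)$ is a positive integer with $c(u,v)\le 2n^5/\epsilon^2$. **Triples.** A triple $(\mathcal T,A_{\rm tour},R)$ consists of integer bucket thresholds $\mathcal T=(t_0,\dots,t_q)$ with $t_0=0$, $q\le\log_2(n+1)$, $t_{i-1}<t_i$ and $t_i\ge\frac43t_{i-1}$ for $i\in[q]=\{1,\dots,q\}$, a set $A_{\rm tour}\subseteq[q]$, and roots $R=(r_i)_{i\in A_{\rm tour}}$, where every client has one colocated copy outside $V$ and each $r_i$ is such a copy. Put $I_i=[t_{i-1},t_i)$, $I_{\rm tour}=\bigcup_{i\in A_{\rm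 tour}}I_i$ and $T=t_q+n^2\max_{u,v\in V\cup\{s,s'\}}c(u,v)$. **Strengthened time-indexed LP of a triple.** The graph $G_T$ has vertex set $((V\cup R)\times[T])\cup\{(s,0),(s',T+1)\}$ and an edge from $(u,t)$ to a different vertex $(v,t')$ iff $c(u,v)\le t'-t$. Let $F_R$ be the set of edges $((u,t),(v,t'))$ for which some $i\in A_{\rm tour}$ satisfies $t<t_{i-1}\le t'$ and $v\ne r_i$, or $t<t_i\le t'$ and $u\neq r_i$. Write $\delta^+(p)$, $\delta^-(p)$ for the edges leaving and entering the vertex $p$, and $\delta^-(S,t)$ for the edges $((u,t'),(v,t))$ with $u\notin S$, $v\in S$. A feasible solution consists of $x\in[0,1]^{V[G_T]}$ and $z\in[0,1]^{E[G_T]}$ with 1. $\sum_{t\in[T]}x_{v,t}=1$ for all $v\in V$, and $x_{v,t}=0$ for all $v\in V$ and $t\in[T]$ with $t\ge t_q$ (clients are visited within $I_1\cup\dots\cup I_q$); 2. $z(\delta^+(v,t))=z(\delta^-(v,t))=x_{v,t}$ for all $v\in V$, $t\in[T]$; 3. $z(\delta^+(s,0))=z(\delta^-(s',T+1))=1$;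 4. $\sum_{t'\in[t]}z(\delta^-(S,t'))\ge\sum_{t'\in[t]}x_{v,t'}$ for all $S\subseteq V\cup R$, $v\in S\cap V$, $t\in[T]$; 5. $z(\delta^-(r,t))=z(\delta^+(r,t))$ for all $r\in R$ and $t\in[T]\cup\{0\}$; 6. $z_e=0$ for all $e\in F_R$; 7. $\sum_{t\in[t_i-1]}(x_{u,t}-x_{v,t})\le\sum_{t\in I_{\rm tour}\cap[T]}(x_{u,t}+x_{v,t})$ for all $u,v\in V$ and $i\in[q-1]$ such that $(u,v)$ is not $t_{i+1}$-short, i.e. such that $c(u,v)>\max\{c(v,u),t_{i+1}\}$. Its cost is $\sum_{v\in V}\sum_{i\in[q]}\sum_{t\in I_i\cap[T]}t_i\,x_{v,t}$. **Theorem.** There are a deterministic algorithm (a fixed program of a random access machine with unit-cost comparison, memory access, addition, truncated subtraction and halving of natural numbers) and constants $C,d\in\mathbb N$ such that for every $\epsilon>0$ and every $\epsilon$-nice instance with $n$ clients the following holds. Given $n$ and the matrix of distances, the algorithm halts after at most $C(n+\frac1\epsilon+1)^d$ steps and outputs a list of at most $C(n+\frac1\epsilon+1)^d$ triples such that, for every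 optimum solution $\mathrm{OPT}$ of the instance, the strengthened time-indexed LP of one of these triples has a feasible solution of cost at most $532\cdot\ell(\mathrm{OPT})$. -/

import Mathlib

/-! ## A random access machine with a step count

A small imperative language over natural-number variables and arrays, with a big-step semantics
that counts elementary operations at unit cost. The only arithmetic is addition, truncated
subtraction and halving, so the bit length of a stored number grows by at most one per elementary
operation; the unit-cost measure is therefore polynomially related to Turing machine time. -/

namespace RAM

/-- Memory contents: variables `reg x`, and arrays `arr a` with cells `arr a i`. -/
structure State where
  reg : ℕ → ℕ
  arr : ℕ → ℕ → ℕ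

/-- Expressions. `load a e` is the cell of array `a` whose index is the value of `e`. -/
inductive Expr where
  | lit (c : ℕ)
  | var (x : ℕ)
  | add (e₁ e₂ : Expr)
  | sub (e₁ e₂ : Expr)
  | half (e : Expr)
  | load (a : ℕ) (e : Expr)

/-- The value of an expression. -/
def Expr.eval (σ : State) : Expr → ℕ
  | .lit c => c
  | .var x => σ.reg x
  | .add e₁ e₂ => e₁.eval σ + e₂.eval σ
  | .sub e₁ e₂ => e₁.eval σ - e₂.eval σ
  | .half e => e.eval σ / 2
  | .load a e => σ.arr a (e.eval σ)

/-- The number of elementary operations in the evaluation of an expression. -/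
def Expr.cost : Expr → ℕ
  | .lit _ => 1
  | .var _ => 1
  | .add e₁ e₂ => e₁.cost + e₂.cost + 1
  | .sub e₁ e₂ => e₁.cost + e₂.cost + 1
  | .half e => e.cost + 1
  | .load _ e => e.cost + 1

/-- Programs. The tests of `ite` and `loop` are comparisons `e₁ < e₂`;
`loop e₁ e₂ p` repeats `p` while `e₁ < e₂`. -/
inductive Prog where
  | skip
  | assign (x : ℕ) (e : Expr)
  | store (a : ℕ) (i e : Expr)
  | seq (p₁ p₂ : Prog)
  | ite (e₁ e₂ : Expr) (p₁ p₂ : Prog)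
  | loop (e₁ e₂ : Expr) (p : Prog)

/-- The state after `x := e`. -/
def State.assign (σ : State) (x : ℕ) (e : Expr) : State :=
  { σ with reg := Function.update σ.reg x (e.eval σ) }

/-- The state after `a[i] := e`. -/
def State.store (σ : State) (a : ℕ) (i e : Expr) : State :=
  { σ with arr := Function.update σ.arr a (Function.update (σ.arr a) (i.eval σ) (e.eval σ)) }

/-- `Exec p σ k τ`: started in `σ`, the program `p` halts in `τ` after exactly `k` steps. -/
inductive Exec : Prog → State → ℕ → State → Prop where
  | skip (σ : State) : Exec .skip σ 1 σ
  | assign (σ : State) (x : ℕ) (e : Expr) :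
      Exec (.assign x e) σ (e.cost + 1) (σ.assign x e)
  | store (σ : State) (a : ℕ) (i e : Expr) :
      Exec (.store a i e) σ (i.cost + e.cost + 1) (σ.store a i e)
  | seq {p₁ p₂ : Prog} {σ τ υ : State} {k₁ k₂ : ℕ} (h₁ : Exec p₁ σ k₁ τ) (h₂ : Exec p₂ τ k₂ υ) :
      Exec (.seq p₁ p₂) σ (k₁ + k₂) υ
  | iteTrue {e₁ e₂ : Expr} {p₁ p₂ : Prog} {σ τ : State} {k : ℕ} (h : e₁.eval σ < e₂.eval σ)
      (h₁ : Exec p₁ σ k τ) : Exec (.ite e₁ e₂ p₁ p₂) σ (e₁.cost + e₂.cost + 1 + k) τ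
  | iteFalse {e₁ e₂ : Expr} {p₁ p₂ : Prog} {σ τ : State} {k : ℕ} (h : ¬ e₁.eval σ < e₂.eval σ)
      (h₂ : Exec p₂ σ k τ) : Exec (.ite e₁ e₂ p₁ p₂) σ (e₁.cost + e₂.cost + 1 + k) τ
  | loopDone {e₁ e₂ : Expr} {p : Prog} {σ : State} (h : ¬ e₁.eval σ < e₂.eval σ) :
      Exec (.loop e₁ e₂ p) σ (e₁.cost + e₂.cost + 1) σ
  | loopStep {e₁ e₂ : Expr} {p : Prog} {σ τ υ : State} {k₁ k₂ : ℕ} (h : e₁.eval σ < e₂.eval σ)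
      (h₁ : Exec p σ k₁ τ) (h₂ : Exec (.loop e₁ e₂ p) τ k₂ υ) :
      Exec (.loop e₁ e₂ p) σ (e₁.cost + e₂.cost + 1 + k₁ + k₂) υ

/-- The output of a halted computation is the word of length `reg 1` in array `1`. -/
def State.HasOutput (σ : State) (w : List ℕ) : Prop :=
  σ.reg 1 = w.length ∧ ∀ (i : ℕ) (h : i < w.length), σ.arr 1 i = w[i]

end RAM

namespace DirLat

/-! ## Directed Latency with Target -/

/-- The points `V ∪ {s, s'}` of an instance with `n` clients. -/
inductive Loc (n : ℕ) where
  | client (v : Fin n)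
  | source
  | target
  deriving DecidableEq, Fintype

/-- An instance with `n` clients: an asymmetric metric on `V ∪ {s, s'}`.
Distances are integral, as in every nice instance. -/
structure Instance (n : ℕ) where
  c : Loc n → Loc n → ℕ
  c_self : ∀ u, c u u = 0
  triangle : ∀ u v w, c u w ≤ c u v + c v w

/-- `ε`-nice instances: `n = 2 ^ k - 1`, and the distances between distinct points are positive
(integers) bounded by `2 n ^ 5 / ε ^ 2`. -/
def Instance.IsNice {n : ℕ} (I : Instance n) (ε : ℝ) : Prop :=
  (∃ k : ℕ, n + 1 = 2 ^ k) ∧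
    ∀ u v, u ≠ v → 0 < I.c u v ∧ (I.c u v : ℝ) ≤ 2 * (n : ℝ) ^ 5 / ε ^ 2

/-- The largest distance. -/
def Instance.maxCost {n : ℕ} (I : Instance n) : ℕ :=
  Finset.univ.sup fun u => Finset.univ.sup fun v => I.c u v

/-- The points of the `s`-`s'`-path that visits the clients in the order `π 0, π 1, …`:
number `0` is `s`, number `j + 1` is `π j`, and number `n + 1` is `s'`. -/
def waypoint {n : ℕ} (π : Equiv.Perm (Fin n)) : ℕ → Loc n
  | 0 => .source
  | j + 1 => if h : j < n then .client (π ⟨j, h⟩) else .target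

/-- The length of the path from `s` to its point number `m`. -/
def Instance.arrival {n : ℕ} (I : Instance n) (π : Equiv.Perm (Fin n)) (m : ℕ) : ℕ :=
  ∑ j ∈ Finset.range m, I.c (waypoint π j) (waypoint π (j + 1))

/-- The total latency: the sum, over all clients, of the length of the path from `s` to the
client. -/
def Instance.latency {n : ℕ} (I : Instance n) (π : Equiv.Perm (Fin n)) : ℕ :=
  ∑ v : Fin n, I.arrival π ((π.symm v : ℕ) + 1)

/-- Optimum solutions. -/
def Instance.IsOptimal {n : ℕ} (I : Instance n) (π : Equiv.Perm (Fin n)) : Prop :=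
  ∀ π' : Equiv.Perm (Fin n), I.latency π ≤ I.latency π'

/-! ## Triples of bucket thresholds, tour-intervals and roots -/

/-- Bucket thresholds `t 0, …, t q`, a set of tour-intervals, and a root for each tour-interval.
The index `i : Fin q` stands for the interval `[t i, t (i + 1))`, and a root is given by the client
at which it is colocated. -/
structure Triple (n : ℕ) where
  q : ℕ
  t : Fin (q + 1) → ℕ
  tour : Finset (Fin q)
  root : {i : Fin q // i ∈ tour} → Fin n

namespace Triple

variable {n : ℕ} (G : Triple n)

/-- The time points of the interval with index `i`. -/
def interval (i : Fin G.q) : Finset ℕ := Finset.Ico (G.t i.castSucc) (G.t i.succ)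

/-- The time points in tour-intervals. -/
def tourTimes : Finset ℕ := G.tour.biUnion G.interval

/-- The set of roots. -/
def roots : Finset (Fin n) := Finset.univ.image G.root

/-- The conditions on bucket thresholds: `t 0 = 0`, the thresholds increase, by a factor of at
least `4 / 3` each time, and `q ≤ log₂ (n + 1)`. -/
def IsValid : Prop :=
  G.t 0 = 0 ∧ 2 ^ G.q ≤ n + 1 ∧
    ∀ i : Fin G.q, G.t i.castSucc < G.t i.succ ∧ 4 * G.t i.castSucc ≤ 3 * G.t i.succ

/-- A triple as a word: `q`, then the thresholds, then for each interval `0` if it is no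
tour-interval, and `v + 1` if it is a tour-interval with root at `v`. -/
def encode : List ℕ :=
  G.q :: (List.ofFn G.t ++
    List.ofFn fun i : Fin G.q => if h : i ∈ G.tour then (G.root ⟨i, h⟩ : ℕ) + 1 else 0)

end Triple

/-- A list of triples as a word: its length, then the words of its members. -/
def encodeTriples {n : ℕ} (L : List (Triple n)) : List ℕ :=
  L.length :: L.flatMap Triple.encode

/-- The points in the order client `0`, …, client `n - 1`, `s`, `s'`. -/
def locOf (n : ℕ) (i : ℕ) : Loc n :=
  if h : i < n then .client ⟨i, h⟩ else if i = n then .source else .target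

/-- The memory at the start of the computation: variable `0` holds `n`, array `0` holds the
distance matrix row by row, and all other cells are `0`. -/
def Instance.input {n : ℕ} (I : Instance n) : RAM.State where
  reg := fun x => if x = 0 then n else 0
  arr := fun a m =>
    if a = 0 ∧ m < (n + 2) * (n + 2) then I.c (locOf n (m / (n + 2))) (locOf n (m % (n + 2)))
    else 0

/-! ## The strengthened time-indexed linear program -/

/-- The points `V ∪ V_copy ∪ {s, s'}`: besides the points of the instance there is a copy
`root v`, colocated at `v`, of every client `v`. -/
inductive Site (n : ℕ) where
  | client (v : Fin n)
  | root (v : Fin n)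
  | source
  | target
  deriving DecidableEq, Fintype

/-- The position of a point in the metric space. -/
def Site.loc {n : ℕ} : Site n → Loc n
  | .client v => .client v
  | .root v => .client v
  | .source => .source
  | .target => .target

/-- The vertices of the time-indexed graph for the points `V ∪ R ∪ {s, s'}` and the horizon `T`:
`(V ∪ R) × {1, …, T}` together with `(s, 0)` and `(s', T + 1)`. -/
def timeVertices {n : ℕ} (R : Finset (Fin n)) (T : ℕ) : Finset (Site n × ℕ) :=
  ((Finset.univ.image .client ∪ R.image .root) ×ˢ Finset.Icc 1 T) ∪
    {(.source, 0), (.target, T + 1)}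

/-- An edge of the time-indexed graph, as a pair of vertices. -/
abbrev TimeEdge (n : ℕ) := (Site n × ℕ) × (Site n × ℕ)

namespace Instance

variable {n : ℕ} (I : Instance n)

/-- The edges of the time-indexed graph: from `(u, t)` to `(v, t')` whenever
`c(u, v) ≤ t' - t`. -/
def timeEdges (R : Finset (Fin n)) (T : ℕ) : Finset (TimeEdge n) :=
  (timeVertices R T ×ˢ timeVertices R T).filter fun e =>
    e.1 ≠ e.2 ∧ e.1.2 + I.c e.1.1.loc e.2.1.loc ≤ e.2.2

/-- `δ⁺(p)`. -/
def outEdges (R : Finset (Fin n)) (T : ℕ) (p : Site n × ℕ) : Finset (TimeEdge n) :=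
  (I.timeEdges R T).filter fun e => e.1 = p

/-- `δ⁻(p)`. -/
def inEdges (R : Finset (Fin n)) (T : ℕ) (p : Site n × ℕ) : Finset (TimeEdge n) :=
  (I.timeEdges R T).filter fun e => e.2 = p

/-- `δ⁻(S, t)`: the edges that enter the point set `S` at time `t`. -/
def entering (R : Finset (Fin n)) (T : ℕ) (S : Finset (Site n)) (t : ℕ) : Finset (TimeEdge n) :=
  (I.timeEdges R T).filter fun e => e.1.1 ∉ S ∧ e.2.1 ∈ S ∧ e.2.2 = t

/-- The polytope `Q` of the time-indexed graph for `V ∪ R ∪ {s, s'}` with horizon `T`. Clients have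
to be visited, while roots may be used by the flow. -/
structure InPolytope (R : Finset (Fin n)) (T : ℕ) (x : Site n × ℕ → ℝ) (z : TimeEdge n → ℝ) :
    Prop where
  x_mem : ∀ p ∈ timeVertices R T, 0 ≤ x p ∧ x p ≤ 1
  z_mem : ∀ e ∈ I.timeEdges R T, 0 ≤ z e ∧ z e ≤ 1
  visit : ∀ v : Fin n, ∑ t ∈ Finset.Icc 1 T, x (.client v, t) = 1
  flow_out : ∀ v : Fin n, ∀ t ∈ Finset.Icc 1 T,
    ∑ e ∈ I.outEdges R T (.client v, t), z e = x (.client v, t)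
  flow_in : ∀ v : Fin n, ∀ t ∈ Finset.Icc 1 T,
    ∑ e ∈ I.inEdges R T (.client v, t), z e = x (.client v, t)
  flow_source : ∑ e ∈ I.outEdges R T (.source, 0), z e = 1
  flow_target : ∑ e ∈ I.inEdges R T (.target, T + 1), z e = 1
  cut : ∀ S : Finset (Site n), (∀ a ∈ S, (∃ v, a = .client v) ∨ ∃ r ∈ R, a = .root r) →
    ∀ v : Fin n, .client v ∈ S → ∀ t ∈ Finset.Icc 1 T,
      ∑ t' ∈ Finset.Icc 1 t, x (.client v, t') ≤
        ∑ t' ∈ Finset.Icc 1 t, ∑ e ∈ I.entering R T S t', z e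

/-- The edge `(u, v)` is `τ`-short. -/
def IsShort (u v : Fin n) (τ : ℕ) : Prop :=
  I.c (.client u) (.client v) ≤ max (I.c (.client v) (.client u)) τ

/-- The time horizon `T = t_q + n² · max c`. -/
def horizon (G : Triple n) : ℕ := G.t (Fin.last G.q) + n ^ 2 * I.maxCost

end Instance

/-- The set `F_R` of forbidden edges: those that enter a tour-interval elsewhere than at its root,
those that leave a tour-interval elsewhere than at its root, and those that skip a
tour-interval. -/
def Triple.Forbidden {n : ℕ} (G : Triple n) (e : TimeEdge n) : Prop :=
  ∃ i : {i : Fin G.q // i ∈ G.tour},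
    (e.1.2 < G.t i.1.castSucc ∧ G.t i.1.castSucc ≤ e.2.2 ∧ e.2.1 ≠ .root (G.root i)) ∨
    (e.1.2 < G.t i.1.succ ∧ G.t i.1.succ ≤ e.2.2 ∧ e.1.1 ≠ .root (G.root i))

namespace Instance

variable {n : ℕ} (I : Instance n)

/-- Feasible solutions of the strengthened time-indexed linear program of a triple. -/
structure IsFeasible (G : Triple n) (x : Site n × ℕ → ℝ) (z : TimeEdge n → ℝ) : Prop where
  mem_polytope : I.InPolytope G.roots (I.horizon G) x z
  /-- Clients are visited within the intervals of the triple. -/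
  within : ∀ v : Fin n, ∀ t ∈ Finset.Icc 1 (I.horizon G), G.t (Fin.last G.q) ≤ t →
    x (.client v, t) = 0
  root_flow : ∀ r ∈ G.roots, ∀ t ∈ Finset.Icc 0 (I.horizon G),
    ∑ e ∈ I.inEdges G.roots (I.horizon G) (.root r, t), z e =
      ∑ e ∈ I.outEdges G.roots (I.horizon G) (.root r, t), z e
  forbidden : ∀ e ∈ I.timeEdges G.roots (I.horizon G), G.Forbidden e → z e = 0
  /-- The index `j` is the successor of `i`; thus `G.t i.succ` and `G.t j.succ` are consecutive
  thresholds, the ends of the intervals `i` and `j`. -/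
  ordering : ∀ (u v : Fin n) (i j : Fin G.q), (j : ℕ) = i + 1 → ¬ I.IsShort u v (G.t j.succ) →
    ∑ t ∈ Finset.Ico 1 (G.t i.succ), (x (.client u, t) - x (.client v, t)) ≤
      ∑ t ∈ Finset.Icc 1 (I.horizon G) ∩ G.tourTimes, (x (.client u, t) + x (.client v, t))

/-- The objective: a visit within an interval is charged the end of the interval. -/
def lpCost (G : Triple n) (x : Site n × ℕ → ℝ) : ℝ :=
  ∑ v : Fin n, ∑ i : Fin G.q, ∑ t ∈ Finset.Icc 1 (I.horizon G) ∩ G.interval i,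
    (G.t i.succ : ℝ) * x (.client v, t)

end Instance

end DirLat

/-!
Fix any path through the `n = 2 ^ k - 1` clients, and cut it into `k` blocks of `2 ^ (k - 1), …, 1`
clients. Let `t j` be the least scale, in a geometric sequence of ratio about `33 / 32` that starts
at `(3 / 2) t (j - 1)`, which is at least `32` times the length of the path up to the end of block
`j`. Stage `j` of the path normally runs to the end of block `j` and is traversed within the
interval before `t j`. But an edge to one of the points that remain of the first `j` blocks, from a
stage without a tour at least two earlier, may fail to be short; then stage `j` is made a tour, and
it ends at the last such bad point. From the bad point one gets back cheaply to an early point of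
the path, so during a tour one can move back and forth cheaply between all clients of block `j - 1`.
Their number `h` exceeds that of the clients after them by one, and therefore any central client
can serve as root of the tour: one that is close from all but fewer than `h` clients and has at
least `h` clients close from it. The root is kept over consecutive tours.

Thus the thresholds and the choice of tour-intervals determine suitable roots. Both are encoded in
binary by one number, whose length is the total number of increases of the scale, logarithmic in the
largest distance and `n`, plus `2 k`, so that there are only polynomially many guesses. The walk
through the clients, shifted into the intervals of their stages, and through the roots is an
integral solution of the linear program. A client of block `j` pays at most `t (j + 1)`. Either a
threshold is at most `33` times the arrival at the end of its block, or it is about `3 / 2` times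
its predecessor while the blocks halve, which makes a geometric sum; and the arrivals at the ends of
the blocks, weighted by their sizes, add up to at most twice the latency.
-/

namespace RAM

/-! ## Step-counted verification of programs -/

namespace Expr

instance : Add Expr := ⟨add⟩

instance : Sub Expr := ⟨sub⟩

@[simp] theorem eval_lit (σ : State) (c : ℕ) : (lit c).eval σ = c := rfl

@[simp] theorem eval_var (σ : State) (x : ℕ) : (var x).eval σ = σ.reg x := rfl

@[simp] theorem eval_add (σ : State) (e₁ e₂ : Expr) :
    (e₁ + e₂).eval σ = e₁.eval σ + e₂.eval σ := rfl

@[simp] theorem eval_sub (σ : State) (e₁ e₂ : Expr) :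
    (e₁ - e₂).eval σ = e₁.eval σ - e₂.eval σ := rfl

@[simp] theorem eval_half (σ : State) (e : Expr) : (half e).eval σ = e.eval σ / 2 := rfl

@[simp] theorem eval_load (σ : State) (a : ℕ) (e : Expr) :
    (load a e).eval σ = σ.arr a (e.eval σ) := rfl

/-- The remainder of a value modulo `2`. -/
def parity (e : Expr) : Expr := e - (half e + half e)

@[simp] theorem eval_parity (σ : State) (e : Expr) : (parity e).eval σ = e.eval σ % 2 := by
  simp only [parity, eval_sub, eval_add, eval_half]
  lia

/-- The indicator of `e₁ ≤ e₂`. -/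
def indicatorLE (e₁ e₂ : Expr) : Expr := lit 1 - (e₁ - e₂)

@[simp] theorem eval_indicatorLE (σ : State) (e₁ e₂ : Expr) :
    (indicatorLE e₁ e₂).eval σ = if e₁.eval σ ≤ e₂.eval σ then 1 else 0 := by
  simp only [indicatorLE, eval_sub, eval_lit]
  split_ifs <;> lia

end Expr

namespace State

@[simp] theorem reg_assign (σ : State) (x : ℕ) (e : Expr) (y : ℕ) :
    (σ.assign x e).reg y = if y = x then e.eval σ else σ.reg y := by
  simp [assign, Function.update_apply]

@[simp] theorem arr_assign (σ : State) (x : ℕ) (e : Expr) : (σ.assign x e).arr = σ.arr := rfl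

@[simp] theorem reg_store (σ : State) (a : ℕ) (i e : Expr) : (σ.store a i e).reg = σ.reg := rfl

@[simp] theorem arr_store (σ : State) (a : ℕ) (i e : Expr) (b m : ℕ) :
    (σ.store a i e).arr b m = if b = a ∧ m = i.eval σ then e.eval σ else σ.arr b m := by
  simp only [store, Function.update_apply]
  split_ifs <;> simp_all

end State

notation:60 p:61 ";;" q:60 => Prog.seq p q

namespace Prog

/-- Whether a program contains an assignment to the variable `x`. -/
def assigns (x : ℕ) : Prog → Bool
  | skip => false
  | assign y _ => y == x
  | store _ _ _ => false
  | seq p q => p.assigns x || q.assigns x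
  | ite _ _ p q => p.assigns x || q.assigns x
  | loop _ _ p => p.assigns x

/-- Whether a program contains a store to the array `a`. -/
def stores (a : ℕ) : Prog → Bool
  | skip => false
  | assign _ _ => false
  | store b _ _ => b == a
  | seq p q => p.stores a || q.stores a
  | ite _ _ p q => p.stores a || q.stores a
  | loop _ _ p => p.stores a

/-- The states agree wherever the program cannot write. -/
structure Frame (p : Prog) (σ τ : State) : Prop where
  reg : ∀ x, p.assigns x = false → τ.reg x = σ.reg x
  arr : ∀ a, p.stores a = false → τ.arr a = σ.arr a

theorem Frame.refl (p : Prog) (σ : State) : p.Frame σ σ := ⟨fun _ _ => rfl, fun _ _ => rfl⟩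

theorem Frame.trans {p : Prog} {σ τ υ : State} (h₁ : p.Frame σ τ) (h₂ : p.Frame τ υ) :
    p.Frame σ υ :=
  ⟨fun x hx => (h₂.reg x hx).trans (h₁.reg x hx), fun a ha => (h₂.arr a ha).trans (h₁.arr a ha)⟩

theorem Frame.mono {p q : Prog} {σ τ : State} (h : p.Frame σ τ)
    (hr : ∀ x, q.assigns x = false → p.assigns x = false)
    (ha : ∀ a, q.stores a = false → p.stores a = false) : q.Frame σ τ :=
  ⟨fun x hx => h.reg x (hr x hx), fun a hx => h.arr a (ha a hx)⟩

/-- Programs without loops. -/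
def isStraight : Prog → Bool
  | skip => true
  | assign _ _ => true
  | store _ _ _ => true
  | seq p q => p.isStraight && q.isStraight
  | ite _ _ p q => p.isStraight && q.isStraight
  | loop _ _ _ => false

/-- The final state of a program without loops; loops are ignored. -/
def apply : Prog → State → State
  | skip, σ => σ
  | assign x e, σ => σ.assign x e
  | store a i e, σ => σ.store a i e
  | seq p q, σ => q.apply (p.apply σ)
  | ite e₁ e₂ p q, σ => if e₁.eval σ < e₂.eval σ then p.apply σ else q.apply σ
  | loop _ _ _, σ => σ

/-- A bound on the number of steps of a program if each of its loops, whenever it is reached, stops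
after at most `N` iterations. -/
def steps (N : ℕ) : Prog → ℕ
  | skip => 1
  | assign _ e => e.cost + 1
  | store _ i e => i.cost + e.cost + 1
  | seq p q => p.steps N + q.steps N
  | ite e₁ e₂ p q => e₁.cost + e₂.cost + 1 + (p.steps N + q.steps N)
  | loop e₁ e₂ p => (N + 1) * (e₁.cost + e₂.cost + 1 + p.steps N)

theorem exists_steps_le (p : Prog) : ∃ C d : ℕ, ∀ N, p.steps N ≤ C * (N + 1) ^ d := by
  have add_le {C C' d d' a b N : ℕ} (ha : a ≤ C * (N + 1) ^ d) (hb : b ≤ C' * (N + 1) ^ d') :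
      a + b ≤ (C + C') * (N + 1) ^ max d d' := by
    rw [add_mul]
    gcongr
    · exact ha.trans (by gcongr; exacts [by lia, le_max_left _ _])
    · exact hb.trans (by gcongr; exacts [by lia, le_max_right _ _])
  induction p with
  | skip => exact ⟨1, 0, fun N => by simp [steps]⟩
  | assign x e => exact ⟨e.cost + 1, 0, fun N => by simp [steps]⟩
  | store a i e => exact ⟨i.cost + e.cost + 1, 0, fun N => by simp [steps]⟩
  | seq p q ihp ihq =>
    obtain ⟨C, d, hp⟩ := ihp
    obtain ⟨C', d', hq⟩ := ihq
    exact ⟨_, _, fun N => add_le (hp N) (hq N)⟩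
  | ite e₁ e₂ p q ihp ihq =>
    obtain ⟨C, d, hp⟩ := ihp
    obtain ⟨C', d', hq⟩ := ihq
    exact ⟨_, _, fun N => add_le (d := 0) (by rw [pow_zero, mul_one]) (add_le (hp N) (hq N))⟩
  | loop e₁ e₂ p ih =>
    obtain ⟨C, d, hp⟩ := ih
    refine ⟨e₁.cost + e₂.cost + 1 + C, max 0 d + 1, fun N => ?_⟩
    rw [steps, pow_succ', mul_left_comm]
    exact Nat.mul_le_mul_left _ (add_le (d := 0) (by rw [pow_zero, mul_one]) (hp N))

end Prog

theorem Exec.frame {p : Prog} {σ τ : State} {k : ℕ} (h : Exec p σ k τ) : p.Frame σ τ := by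
  induction h with
  | skip => exact .refl _ _
  | assign σ x e =>
    refine ⟨fun y hy => ?_, fun _ _ => rfl⟩
    exact Function.update_of_ne (beq_eq_false_iff_ne.1 hy).symm _ _
  | store σ a i e =>
    refine ⟨fun _ _ => rfl, fun b hb => ?_⟩
    exact Function.update_of_ne (beq_eq_false_iff_ne.1 hb).symm _ _
  | seq _ _ ih₁ ih₂ =>
    exact Prog.Frame.trans (p := .seq _ _)
      (ih₁.mono (fun _ h => (Bool.or_eq_false_iff.1 h).1) fun _ h => (Bool.or_eq_false_iff.1 h).1)
      (ih₂.mono (fun _ h => (Bool.or_eq_false_iff.1 h).2) fun _ h => (Bool.or_eq_false_iff.1 h).2)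
  | iteTrue _ _ ih =>
    exact ih.mono (fun _ h => (Bool.or_eq_false_iff.1 h).1) fun _ h => (Bool.or_eq_false_iff.1 h).1
  | iteFalse _ _ ih =>
    exact ih.mono (fun _ h => (Bool.or_eq_false_iff.1 h).2) fun _ h => (Bool.or_eq_false_iff.1 h).2
  | loopDone => exact .refl _ _
  | loopStep _ _ _ ih₁ ih₂ => exact Prog.Frame.trans ⟨ih₁.reg, ih₁.arr⟩ ih₂

theorem Exec.exists_of_isStraight {p : Prog} (hp : p.isStraight) (N : ℕ) (σ : State) :
    ∃ k ≤ p.steps N, Exec p σ k (p.apply σ) := by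
  induction p generalizing σ with
  | skip => exact ⟨1, le_rfl, .skip σ⟩
  | assign x e => exact ⟨_, le_rfl, .assign σ x e⟩
  | store a i e => exact ⟨_, le_rfl, .store σ a i e⟩
  | seq p q ihp ihq =>
    rw [Prog.isStraight, Bool.and_eq_true] at hp
    obtain ⟨k, hk, h⟩ := ihp hp.1 σ
    obtain ⟨l, hl, h'⟩ := ihq hp.2 (p.apply σ)
    exact ⟨_, Nat.add_le_add hk hl, .seq h h'⟩
  | ite e₁ e₂ p q ihp ihq =>
    rw [Prog.isStraight, Bool.and_eq_true] at hp
    obtain ⟨k, hk, h⟩ := ihp hp.1 σ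
    obtain ⟨l, hl, h'⟩ := ihq hp.2 σ
    by_cases hlt : e₁.eval σ < e₂.eval σ
    · exact ⟨e₁.cost + e₂.cost + 1 + k, by simp only [Prog.steps]; lia, by
        simpa only [Prog.apply, if_pos hlt] using .iteTrue hlt h⟩
    · exact ⟨e₁.cost + e₂.cost + 1 + l, by simp only [Prog.steps]; lia, by
        simpa only [Prog.apply, if_neg hlt] using .iteFalse hlt h'⟩
  | loop => exact absurd hp Bool.false_ne_true

/-- Total correctness with a bound on loops: started in `σ`, the program `p` halts in a state that
satisfies `Q`, within the number of steps that `N` iterations of each loop allow. -/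
def Runs (N : ℕ) (p : Prog) (σ : State) (Q : State → Prop) : Prop :=
  ∃ k ≤ p.steps N, ∃ τ, Exec p σ k τ ∧ Q τ

namespace Runs

variable {N : ℕ} {p q : Prog} {σ : State} {Q R : State → Prop}

theorem imp_of_frame (h : Runs N p σ R) (hQ : ∀ τ, p.Frame σ τ → R τ → Q τ) : Runs N p σ Q :=
  let ⟨k, hk, τ, hexec, hτ⟩ := h
  ⟨k, hk, τ, hexec, hQ τ hexec.frame hτ⟩

theorem straight (hQ : Q (p.apply σ)) (hp : p.isStraight := by rfl) : Runs N p σ Q :=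
  let ⟨k, hk, hexec⟩ := Exec.exists_of_isStraight hp N σ
  ⟨k, hk, _, hexec, hQ⟩

theorem seq (hp : Runs N p σ R) (hq : ∀ τ, p.Frame σ τ → R τ → Runs N q τ Q) :
    Runs N (p ;; q) σ Q := by
  obtain ⟨k, hk, τ, h₁, k', hk', υ, h₂, hυ⟩ := hp.imp_of_frame hq
  exact ⟨k + k', Nat.add_le_add hk hk', υ, .seq h₁ h₂, hυ⟩

theorem loop {e₁ e₂ : Expr} {m : ℕ} (hm : m ≤ N) (P : ℕ → State → Prop) (zero : P 0 σ)
    (step : ∀ i < m, ∀ τ, p.Frame σ τ → P i τ → e₁.eval τ < e₂.eval τ ∧ Runs N p τ (P (i + 1)))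
    (done : ∀ τ, p.Frame σ τ → P m τ → ¬ e₁.eval τ < e₂.eval τ) :
    Runs N (.loop e₁ e₂ p) σ (P m) := by
  suffices key : ∀ j i, i + j = m → ∀ τ, p.Frame σ τ → P i τ →
      ∃ k ≤ (j + 1) * (e₁.cost + e₂.cost + 1 + p.steps N), ∃ υ, Exec (.loop e₁ e₂ p) τ k υ ∧
        P m υ by
    obtain ⟨k, hk, h⟩ := key m 0 (zero_add m) σ (.refl p σ) zero
    exact ⟨k, hk.trans (Nat.mul_le_mul_right _ (by lia)), h⟩
  intro j
  induction j with
  | zero =>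
    rintro i rfl τ hf hτ
    exact ⟨_, by lia, τ, .loopDone (done τ hf hτ), hτ⟩
  | succ j ih =>
    intro i hi τ hf hτ
    obtain ⟨hlt, k, hk, υ, h₁, hυ⟩ := step i (by lia) τ hf hτ
    obtain ⟨k', hk', ω, h₂, hω⟩ := ih (i + 1) (by lia) υ (hf.trans h₁.frame) hυ
    refine ⟨e₁.cost + e₂.cost + 1 + k + k', ?_, ω, .loopStep hlt h₁ h₂, hω⟩
    rw [Nat.succ_mul]
    lia

end Runs

end RAM

namespace DirLat

/-! ## Guesses of thresholds, tour-intervals and roots -/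

/-- The number of trailing ones in the binary expansion. -/
def ones (g : ℕ) : ℕ := if g % 2 = 1 then ones (g / 2) + 1 else 0
termination_by g
decreasing_by lia

theorem ones_le (g : ℕ) : ones g ≤ g := by
  induction g using Nat.strong_induction_on with
  | _ g ih =>
    unfold ones
    split_ifs with h
    · have := ih (g / 2) (by lia)
      lia
    · lia

theorem odd_of_lt_ones {g i : ℕ} (hi : i < ones g) : g / 2 ^ i % 2 = 1 := by
  induction i generalizing g with
  | zero =>
    unfold ones at hi
    split_ifs at hi with h
    · simpa using h
    · lia
  | succ i ih =>
    unfold ones at hi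
    split_ifs at hi with h
    · have := ih (g := g / 2) (by lia)
      rwa [Nat.div_div_eq_div_mul, ← pow_succ'] at this
    · lia

/-- What remains of the binary expansion after the trailing ones. -/
def dropOnes (g : ℕ) : ℕ := g / 2 ^ ones g

theorem even_dropOnes (g : ℕ) : dropOnes g % 2 = 0 := by
  induction g using Nat.strong_induction_on with
  | _ g ih =>
    rw [dropOnes, ones]
    split_ifs with h
    · rw [pow_succ', ← Nat.div_div_eq_div_mul]
      exact ih (g / 2) (by lia)
    · rw [pow_zero, Nat.div_one]
      lia

theorem ones_append {g : ℕ} (hg : g % 2 = 0) (m : ℕ) : ones (g * 2 ^ m + (2 ^ m - 1)) = m := by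
  induction m with
  | zero => unfold ones; simp [hg]
  | succ m ih =>
    have hodd : g * 2 ^ (m + 1) + (2 ^ (m + 1) - 1) = 2 * (g * 2 ^ m + (2 ^ m - 1)) + 1 := by
      have := Nat.two_pow_pos m
      rw [pow_succ, ← mul_assoc]
      lia
    rw [hodd, ones, if_pos (Nat.mul_add_mod 2 _ 1), Nat.mul_add_div two_pos,
      Nat.div_eq_of_lt one_lt_two, add_zero, ih]

theorem dropOnes_append {g : ℕ} (hg : g % 2 = 0) (m : ℕ) :
    dropOnes (g * 2 ^ m + (2 ^ m - 1)) = g := by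
  have := Nat.two_pow_pos m
  rw [dropOnes, ones_append hg, mul_comm, Nat.mul_add_div this, Nat.div_eq_of_lt (by lia),
    add_zero]

/-- What is left of a guess after `j` stages. Read from the least significant bit, a stage consists
of a run of ones, the number of times that the current scale is increased by the factor `33 / 32`
before it becomes the next threshold, a zero, and a bit that tells whether the interval which ends
at this threshold is a tour-interval. After each threshold the scale grows by the factor `3 / 2`. -/
def guessAt (g : ℕ) : ℕ → ℕ
  | 0 => g
  | j + 1 => dropOnes (guessAt g j) / 4

theorem guessAt_le (g j : ℕ) : guessAt g j ≤ g := by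
  induction j with
  | zero => rfl
  | succ j ih => exact (Nat.div_le_self _ _).trans ((Nat.div_le_self _ _).trans ih)

theorem guessAt_succ' (g j : ℕ) : guessAt g (j + 1) = guessAt (guessAt g 1) j := by
  induction j with
  | zero => rfl
  | succ j ih => exact congrArg (dropOnes · / 4) ih

/-- The bit of stage `j + 1` that is `1` for tour-intervals. -/
def tourBit (g j : ℕ) : ℕ := dropOnes (guessAt g j) / 2 % 2

/-- The finer of the two factors in the growth of thresholds, `33 / 32`, up to rounding. -/
def grow (s : ℕ) : ℕ := s + s / 32

/-- The scale at the start of stage `j + 1`. It is at least `32`, so that `grow` increases it. -/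
def scale (g : ℕ) : ℕ → ℕ
  | 0 => 32
  | j + 1 => grow^[ones (guessAt g j)] (scale g j) + grow^[ones (guessAt g j)] (scale g j) / 2

/-- The thresholds of a guess. -/
def threshold (g : ℕ) : ℕ → ℕ
  | 0 => 0
  | j + 1 => grow^[ones (guessAt g j)] (scale g j)

theorem scale_succ (g j : ℕ) : scale g (j + 1) = threshold g (j + 1) + threshold g (j + 1) / 2 :=
  rfl

theorem le_grow (s : ℕ) : s ≤ grow s := Nat.le_add_right _ _

theorem le_grow_iterate (i s : ℕ) : s ≤ grow^[i] s := by
  induction i generalizing s with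
  | zero => rfl
  | succ i ih => exact (le_grow s).trans (ih _)

theorem scale_le_threshold (g j : ℕ) : scale g j ≤ threshold g (j + 1) := le_grow_iterate _ _

theorem le_scale (g j : ℕ) : 32 ≤ scale g j := by
  induction j with
  | zero => rfl
  | succ j ih => exact (ih.trans (scale_le_threshold g j)).trans (Nat.le_add_right _ _)

theorem three_mul_threshold_le (g j : ℕ) : 3 * threshold g j ≤ 2 * threshold g (j + 1) + 1 := by
  have h := scale_le_threshold g j
  cases j with
  | zero => exact Nat.zero_le _
  | succ j =>
    rw [scale_succ] at h
    lia

theorem threshold_step (g j : ℕ) :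
    threshold g j < threshold g (j + 1) ∧ 4 * threshold g j ≤ 3 * threshold g (j + 1) := by
  have h := three_mul_threshold_le g j
  have h' := (le_scale g j).trans (scale_le_threshold g j)
  lia

theorem exists_guess (k : ℕ) (a : ℕ → ℕ) (b : ℕ → Prop) :
    ∃ g < 2 ^ (∑ i ∈ Finset.range k, a i) * 4 ^ k,
      ∀ j < k, ones (guessAt g j) = a j ∧ (0 < tourBit g j ↔ b j) := by
  induction k generalizing a b with
  | zero => exact ⟨0, by simp, by simp⟩
  | succ k ih =>
    classical
    obtain ⟨g', hg', h⟩ := ih (fun i => a (i + 1)) (fun i => b (i + 1))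
    have : (if b 0 then 2 else 0) = 0 ∨ (if b 0 then 2 else 0) = 2 := by split_ifs <;> simp
    set e := 4 * g' + (if b 0 then 2 else 0) with he
    have heven : e % 2 = 0 := by lia
    have hdrop := dropOnes_append heven (a 0)
    set g := e * 2 ^ a 0 + (2 ^ a 0 - 1)
    have hnext : guessAt g 1 = g' := by
      rw [guessAt, guessAt, hdrop]
      lia
    refine ⟨g, ?_, fun j hj => ?_⟩
    · have hpos := Nat.two_pow_pos (a 0)
      calc g < (e + 1) * 2 ^ a 0 := by rw [add_mul]; lia
        _ ≤ (4 * (2 ^ (∑ i ∈ Finset.range k, a (i + 1)) * 4 ^ k)) * 2 ^ a 0 :=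
          Nat.mul_le_mul_right _ (by lia)
        _ = _ := by rw [Finset.sum_range_succ']; ring
    · cases j with
      | zero =>
        refine ⟨ones_append heven _, ?_⟩
        rw [tourBit, guessAt, hdrop, he]
        split_ifs with hb0 <;> simp only [hb0, iff_true, iff_false] <;> lia
      | succ j =>
        rw [tourBit, guessAt_succ', hnext]
        exact h j (by lia)

/-- The number of clients from which `r` is within distance `d`. -/
def ballIn (c : ℕ → ℕ → ℕ) (n d r : ℕ) : ℕ := Nat.count (fun w => c w r ≤ d) n

/-- The number of clients within distance `d` from `r`. -/
def ballOut (c : ℕ → ℕ → ℕ) (n d r : ℕ) : ℕ := Nat.count (fun w => c r w ≤ d) n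

/-- The client `r` is within distance `d` from all but fewer than `h` clients, and at least
`h` clients are within distance `2 d` from `r`. -/
def IsCentral (c : ℕ → ℕ → ℕ) (n d h r : ℕ) : Prop :=
  n < ballIn c n d r + h ∧ h ≤ ballOut c n (2 * d) r

instance (c : ℕ → ℕ → ℕ) (n d h : ℕ) : DecidablePred (IsCentral c n d h) :=
  fun _ => inferInstanceAs (Decidable (_ ∧ _))

/-- The last central client, plus one; `0` if there is none. -/
def centralWord (c : ℕ → ℕ → ℕ) (n d h : ℕ) : ℕ :=
  Nat.findGreatest (fun w => IsCentral c n d h (w - 1)) n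

theorem isCentral_centralWord {c : ℕ → ℕ → ℕ} {n d h r : ℕ} (hr : r < n)
    (hc : IsCentral c n d h r) :
    0 < centralWord c n d h ∧ IsCentral c n d h (centralWord c n d h - 1) := by
  have hc' : IsCentral c n d h (r + 1 - 1) := hc
  exact ⟨r.succ_pos.trans_le (Nat.le_findGreatest hr hc'),
    Nat.findGreatest_spec (P := fun w => IsCentral c n d h (w - 1)) hr hc'⟩

/-- The word for stage `j` of a guess: `0` if it has no tour-interval, and `r + 1` if it has one
with root `r`. The root is a central client, and it is kept as long as tour-intervals follow each
other. -/
def word (c : ℕ → ℕ → ℕ) (n g : ℕ) : ℕ → ℕ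
  | 0 => 0
  | j + 1 =>
    if 0 < tourBit g j then
      if 0 < word c n g j then word c n g j
      else centralWord c n (threshold g (j + 1) / 32) ((n + 1) / 2 ^ j)
    else 0

theorem word_le (c : ℕ → ℕ → ℕ) (n g j : ℕ) : word c n g j ≤ n := by
  induction j with
  | zero => exact n.zero_le
  | succ j ih =>
    rw [word]
    split_ifs
    exacts [ih, Nat.findGreatest_le n, n.zero_le]

/-- The triple with `q` intervals that has thresholds `t` and is given by words `w` as in
`Triple.encode`. -/
def Triple.ofWords {n : ℕ} (q : ℕ) (t w : ℕ → ℕ) (hw : ∀ j, w j ≤ n) : Triple n where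
  q := q
  t := fun i => t i
  tour := {i | 0 < w (i + 1)}
  root := fun i => ⟨w (i.1 + 1) - 1, by
    have := hw (i.1 + 1)
    have := (Finset.mem_filter.1 i.2).2
    lia⟩

theorem Triple.encode_ofWords {n : ℕ} (q : ℕ) (t w : ℕ → ℕ) (hw : ∀ j, w j ≤ n) :
    (ofWords q t w hw).encode =
      q :: ((List.range (q + 1)).map t ++ (List.range q).map fun j => w (j + 1)) := by
  have key (i : Fin (ofWords q t w hw).q) : (if h : i ∈ (ofWords q t w hw).tour then
      ((ofWords q t w hw).root ⟨i, h⟩ : ℕ) + 1 else 0) = w (i + 1) := by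
    have hmem : i ∈ (ofWords q t w hw).tour ↔ 0 < w (i + 1) := Finset.mem_filter_univ i
    split_ifs with h
    · exact Nat.sub_add_cancel (hmem.1 h)
    · have := mt hmem.2 h
      lia
  rw [← List.map_coe_finRange_eq_range, ← List.map_coe_finRange_eq_range, List.map_map,
    List.map_map, encode, List.ofFn_eq_map, List.ofFn_eq_map]
  exact congrArg (fun l => q :: (_ ++ l)) (List.map_congr_left fun i _ => key i)

namespace Instance

variable {n : ℕ} (I : Instance n)

/-- The distance between points given by their numbers. -/
def cost (a b : ℕ) : ℕ := I.c (locOf n a) (locOf n b)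

/-- The triple with `k` intervals that a guess encodes. -/
def decode (k g : ℕ) : Triple n :=
  .ofWords k (threshold g) (word I.cost n g) (word_le I.cost n g)

theorem isValid_decode {k : ℕ} (hk : n + 1 = 2 ^ k) (g : ℕ) : (I.decode k g).IsValid :=
  ⟨rfl, hk.ge, fun i => threshold_step g i⟩

end Instance

end DirLat

/-! ## The algorithm -/

namespace RAM

namespace Expr

/-- The value of an expression, divided by `32`. -/
def div32 (e : Expr) : Expr := half (half (half (half (half e))))

@[simp] theorem eval_div32 (σ : State) (e : Expr) : (div32 e).eval σ = e.eval σ / 32 := by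
  simp only [div32, eval_half]
  lia

end Expr

/-- The program that appends the value of an expression to the output. -/
def emit (e : Expr) : Prog := .store 1 (.var 1) e ;; .assign 1 (.var 1 + .lit 1)

theorem Prog.Frame.hasOutput {p : Prog} {σ τ : State} {w : List ℕ} (hf : p.Frame σ τ)
    (h : σ.HasOutput w) (hr : p.assigns 1 = false := by rfl)
    (ha : p.stores 1 = false := by rfl) : τ.HasOutput w := by
  rwa [State.HasOutput, hf.reg 1 hr, hf.arr 1 ha]

theorem runs_emit {N : ℕ} {σ : State} {w : List ℕ} (h : σ.HasOutput w) (e : Expr) :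
    Runs N (emit e) σ (·.HasOutput (w ++ [e.eval σ])) := by
  refine .straight ⟨?_, fun i hi => ?_⟩
  · simp [emit, Prog.apply, h.1]
  · rw [List.length_append, List.length_singleton] at hi
    simp only [emit, Prog.apply, State.arr_assign, State.arr_store, Expr.eval_var, h.1]
    rcases Nat.lt_succ_iff_lt_or_eq.1 hi with hi | rfl
    · simp [List.getElem_append_left hi, h.2 i hi, hi.ne]
    · simp

end RAM

namespace DirLat

open RAM

namespace Reg

/-! Names for the variables of the program. Variable `0` is set by the input, and variable `1` and
array `1` are those of `State.HasOutput`. -/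

@[simp] abbrev clients : ℕ := 0
@[simp] abbrev stages : ℕ := 2
@[simp] abbrev reach : ℕ := 3
@[simp] abbrev guesses : ℕ := 4
@[simp] abbrev guess : ℕ := 5
@[simp] abbrev stage : ℕ := 6
@[simp] abbrev code : ℕ := 7
@[simp] abbrev level : ℕ := 8
@[simp] abbrev need : ℕ := 9
@[simp] abbrev current : ℕ := 10
@[simp] abbrev found : ℕ := 11
@[simp] abbrev candidate : ℕ := 12
@[simp] abbrev client : ℕ := 13
@[simp] abbrev inCount : ℕ := 14
@[simp] abbrev outCount : ℕ := 15
@[simp] abbrev index : ℕ := 16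
@[simp] abbrev offset : ℕ := 17

end Reg

namespace Arr

@[simp] abbrev matrix : ℕ := 0
@[simp] abbrev rows : ℕ := 2
@[simp] abbrev words : ℕ := 3

end Arr

open Reg Arr

/-- The variable for the number of clients and the arrays for the matrix `c` and for the offsets of
its rows are set. -/
structure HoldsMatrix (c : ℕ → ℕ → ℕ) (n : ℕ) (σ : State) : Prop where
  clients : σ.reg clients = n
  dist : ∀ a < n + 2, ∀ b < n + 2, σ.arr matrix (σ.arr rows a + b) = c a b

theorem HoldsMatrix.of_frame {c : ℕ → ℕ → ℕ} {n : ℕ} {p : Prog} {σ τ : State}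
    (h : HoldsMatrix c n σ) (hf : p.Frame σ τ) (h₀ : p.assigns Reg.clients = false := by rfl)
    (h₁ : p.stores matrix = false := by rfl) (h₂ : p.stores rows = false := by rfl) :
    HoldsMatrix c n τ :=
  ⟨(hf.reg _ h₀).trans h.clients, by rw [hf.arr _ h₁, hf.arr _ h₂]; exact h.dist⟩

/-- The distance between the points with the given numbers. -/
def distExpr (a b : Expr) : Expr := .load matrix (.load rows a + b)

/-- Counts the clients close to and from the candidate. -/
def countProg : Prog :=
  (.assign inCount (.lit 0) ;; .assign outCount (.lit 0) ;; .assign client (.lit 0)) ;;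
  .loop (.var client) (.var clients) (
    .assign inCount (.var inCount +
      .indicatorLE (distExpr (.var client) (.var candidate)) (.div32 (.var level))) ;;
    .assign outCount (.var outCount +
      .indicatorLE (distExpr (.var candidate) (.var client))
        (.div32 (.var level) + .div32 (.var level))) ;;
    .assign client (.var client + .lit 1))

theorem runs_countProg {c : ℕ → ℕ → ℕ} {n r N : ℕ} {σ : State} (hσ : HoldsMatrix c n σ)
    (hN : n ≤ N) (hr : r < n) (hcand : σ.reg candidate = r) :
    Runs N countProg σ fun τ =>
      τ.reg inCount = ballIn c n (σ.reg level / 32) r ∧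
      τ.reg outCount = ballOut c n (2 * (σ.reg level / 32)) r := by
  refine (Runs.straight (Q := fun τ => τ.reg inCount = 0 ∧ τ.reg outCount = 0 ∧
    τ.reg client = 0) (by simp [Prog.apply])).seq fun τ hf hτ => ?_
  refine (Runs.loop hN (fun i υ => υ.reg client = i ∧
      υ.reg inCount = Nat.count (fun w => c w r ≤ σ.reg level / 32) i ∧
      υ.reg outCount = Nat.count (fun w => c r w ≤ 2 * (σ.reg level / 32)) i)
    ?_ ?_ ?_).imp_of_frame fun υ _ hυ => hυ.2
  · simp [hτ]
  · rintro i hi υ hf' ⟨hclient, hin, hout⟩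
    have hυ := (hσ.of_frame hf).of_frame hf'
    have hcand' : υ.reg candidate = r := by rw [hf'.reg _ rfl, hf.reg _ rfl, hcand]
    have hlevel : υ.reg level = σ.reg level := by rw [hf'.reg _ rfl, hf.reg _ rfl]
    refine ⟨by simpa [hclient, hυ.clients] using hi, .straight ?_⟩
    simp [Prog.apply, distExpr, Nat.count_succ, two_mul, hclient, hcand', hlevel, hin, hout,
      hυ.dist i (by lia) r (by lia), hυ.dist r (by lia) i (by lia)]
  · rintro υ hf' ⟨hclient, -⟩
    simp [hclient, (hσ.of_frame hf).of_frame hf' |>.clients]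

/-- Searches for a central client among all candidates. -/
def searchProg : Prog :=
  (.assign found (.lit 0) ;; .assign candidate (.lit 0)) ;;
  .loop (.var candidate) (.var clients) (
    countProg ;;
    .ite (.var clients) (.var inCount + .var need)
      (.ite (.var outCount) (.var need) .skip (.assign found (.var candidate + .lit 1))) .skip ;;
    .assign candidate (.var candidate + .lit 1))

theorem runs_searchProg {c : ℕ → ℕ → ℕ} {n N : ℕ} {σ : State} (hσ : HoldsMatrix c n σ)
    (hN : n ≤ N) :
    Runs N searchProg σ fun τ => τ.reg found = centralWord c n (σ.reg level / 32) (σ.reg need) := by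
  refine (Runs.straight (Q := fun τ => τ.reg found = 0 ∧ τ.reg candidate = 0)
    (by simp [Prog.apply])).seq fun τ hf hτ => ?_
  refine (Runs.loop hN (fun i υ => υ.reg candidate = i ∧ υ.reg found = Nat.findGreatest
      (fun w => IsCentral c n (σ.reg level / 32) (σ.reg need) (w - 1)) i)
    ?_ ?_ ?_).imp_of_frame fun υ _ hυ => hυ.2
  · simp [hτ]
  · rintro i hi υ hf' ⟨hcand, hfound⟩
    have hυ := (hσ.of_frame hf).of_frame hf'
    refine ⟨by simpa [hcand, hυ.clients] using hi, (runs_countProg hυ hN hi hcand).seq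
      fun ω hf'' ⟨hin, hout⟩ => .straight ?_⟩
    have hneed : ω.reg need = σ.reg need := by
      rw [hf''.reg _ rfl, hf'.reg _ rfl, hf.reg _ rfl]
    have hlevel : υ.reg level = σ.reg level := by rw [hf'.reg _ rfl, hf.reg _ rfl]
    have hcand' : ω.reg candidate = i := by rw [hf''.reg _ rfl, hcand]
    have hfound' := (hf''.reg found rfl).trans hfound
    have hiff : IsCentral c n (σ.reg level / 32) (σ.reg need) i ↔
        ω.reg clients < ω.reg inCount + ω.reg need ∧ ¬ ω.reg outCount < ω.reg need := by
      rw [hin, hout, hneed, hlevel, (hυ.of_frame hf'').clients, not_lt, IsCentral]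
    rw [Nat.findGreatest_succ, Nat.add_sub_cancel, ← hfound', ← hcand']
    rw [← hcand'] at hiff
    by_cases h₁ : ω.reg clients < ω.reg inCount + ω.reg need <;>
      by_cases h₂ : ω.reg outCount < ω.reg need <;>
      simp [Prog.apply, -not_lt, hiff, h₁, h₂]
  · rintro υ hf' ⟨hcand, -⟩
    simp [hcand, (hσ.of_frame hf).of_frame hf' |>.clients]

/-- Reads a run of ones of the guess. -/
def growProg : Prog :=
  .loop (.lit 0) (.parity (.var code)) (
    .assign code (.half (.var code)) ;; .assign level (.var level + .div32 (.var level)))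

theorem runs_growProg {N : ℕ} (σ : State) (hN : σ.reg code ≤ N) :
    Runs N growProg σ fun τ => τ.reg code = dropOnes (σ.reg code) ∧
      τ.reg level = grow^[ones (σ.reg code)] (σ.reg level) := by
  refine .loop ((ones_le _).trans hN) (fun i τ => τ.reg code = σ.reg code / 2 ^ i ∧
    τ.reg level = grow^[i] (σ.reg level)) (by simp) ?_ ?_
  · rintro i hi τ - ⟨hcode, hlevel⟩
    refine ⟨by simp [hcode, odd_of_lt_ones hi], .straight ?_⟩
    simp [Prog.apply, hcode, hlevel, Nat.div_div_eq_div_mul, pow_succ,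
      Function.iterate_succ_apply', grow]
  · rintro τ - ⟨hcode, -⟩
    rw [Expr.eval_lit, Expr.eval_parity, Expr.eval_var, hcode, ← dropOnes, even_dropOnes]
    exact lt_irrefl 0

/-- Updates the word of the stage whose threshold has been read. -/
def wordProg : Prog :=
  searchProg ;;
  .ite (.lit 0) (.parity (.half (.var code)))
    (.ite (.lit 0) (.var current) .skip (.assign current (.var found)))
    (.assign current (.lit 0))

theorem runs_wordProg {c : ℕ → ℕ → ℕ} {n g j N : ℕ} {σ : State} (hσ : HoldsMatrix c n σ)
    (hN : n ≤ N) (hcode : σ.reg code = dropOnes (guessAt g j))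
    (hlevel : σ.reg level = threshold g (j + 1)) (hneed : σ.reg need = (n + 1) / 2 ^ j)
    (hcurrent : σ.reg current = word c n g j) :
    Runs N wordProg σ fun τ => τ.reg current = word c n g (j + 1) := by
  refine (runs_searchProg hσ hN).seq fun τ hf hfound => .straight ?_
  rw [hlevel, hneed] at hfound
  rw [← hf.reg _ rfl] at hcode hcurrent
  rw [word, tourBit, ← hcode, ← hcurrent, ← hfound]
  by_cases h₁ : 0 < τ.reg code / 2 % 2 <;> by_cases h₂ : 0 < τ.reg current <;>
    simp [Prog.apply, h₁, h₂]

/-- Reads a stage of the guess: writes its threshold, and stores its word. -/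
def stageProg : Prog :=
  growProg ;; emit (.var level) ;; wordProg ;;
  .store words (.var stage) (.var current) ;;
  .assign code (.half (.half (.var code))) ;;
  .assign level (.var level + .half (.var level)) ;;
  .assign need (.half (.var need)) ;;
  .assign stage (.var stage + .lit 1)

/-- The state before stage `j + 1` of the guess `g`, if the output was `w` before the thresholds
were written. -/
structure AtStage (c : ℕ → ℕ → ℕ) (n g : ℕ) (w : List ℕ) (j : ℕ) (σ : State) : Prop where
  stage : σ.reg stage = j
  code : σ.reg code = guessAt g j
  level : σ.reg level = scale g j
  need : σ.reg need = (n + 1) / 2 ^ j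
  current : σ.reg current = word c n g j
  words : ∀ i < j, σ.arr words i = word c n g (i + 1)
  output : σ.HasOutput (w ++ (List.range (j + 1)).map (threshold g))

theorem runs_stageProg {c : ℕ → ℕ → ℕ} {n g j N : ℕ} {w : List ℕ} {σ : State}
    (hσ : HoldsMatrix c n σ) (h : AtStage c n g w j σ) (hn : n ≤ N) (hg : g ≤ N) :
    Runs N stageProg σ (AtStage c n g w (j + 1)) := by
  refine (runs_growProg σ (h.code ▸ (guessAt_le g j).trans hg)).seq fun τ hf ⟨hcode, hlevel⟩ => ?_
  rw [h.code] at hcode hlevel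
  rw [h.level] at hlevel
  change τ.reg level = threshold g (j + 1) at hlevel
  refine (runs_emit (hf.hasOutput h.output) _).seq fun υ hf₁ hout => ?_
  rw [Expr.eval_var, hlevel, List.append_assoc] at hout
  rw [← hf₁.reg _ rfl] at hcode hlevel
  have hneed := (hf₁.reg need rfl).trans ((hf.reg need rfl).trans h.need)
  have hcurrent := (hf₁.reg current rfl).trans ((hf.reg current rfl).trans h.current)
  refine (runs_wordProg ((hσ.of_frame hf).of_frame hf₁) hn hcode hlevel hneed hcurrent).seq
    fun ω hf₂ hword => .straight ?_
  rw [← hf₂.reg _ rfl] at hcode hlevel hneed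
  have hstage : ω.reg stage = j := by
    rw [hf₂.reg _ rfl, hf₁.reg _ rfl, hf.reg _ rfl, h.stage]
  have hwords : ω.arr words = σ.arr words := by
    rw [hf₂.arr _ rfl, hf₁.arr _ rfl, hf.arr _ rfl]
  refine ⟨?_, ?_, ?_, ?_, ?_, ?_, ?_⟩
  · simp [Prog.apply, hstage]
  · simp [Prog.apply, hcode, guessAt, Nat.div_div_eq_div_mul]
  · simp [Prog.apply, hlevel, scale_succ]
  · simp [Prog.apply, hneed, Nat.div_div_eq_div_mul, pow_succ]
  · simpa [Prog.apply] using hword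
  · intro i hi
    rcases Nat.lt_succ_iff_lt_or_eq.1 hi with hi | rfl
    · simp [Prog.apply, hstage, hwords, h.words i hi, hi.ne]
    · simp [Prog.apply, hstage, hword]
  · rw [List.range_succ, List.map_append]
    simpa [State.HasOutput, Prog.apply] using hf₂.hasOutput hout

/-- Writes the words of the stages. -/
def emitWordsProg : Prog :=
  .assign stage (.lit 0) ;;
  .loop (.var stage) (.var stages) (
    emit (.load words (.var stage)) ;; .assign stage (.var stage + .lit 1))

theorem runs_emitWordsProg {N k : ℕ} {w : List ℕ} {σ : State} (hk : k ≤ N)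
    (hstages : σ.reg stages = k) (hσ : σ.HasOutput w) :
    Runs N emitWordsProg σ (·.HasOutput (w ++ (List.range k).map (σ.arr words))) := by
  refine (Runs.straight (Q := (·.reg stage = 0)) (by simp [Prog.apply])).seq fun τ hf hτ => ?_
  refine (Runs.loop hk (fun i υ => υ.reg stage = i ∧
    υ.HasOutput (w ++ (List.range i).map (σ.arr words))) ?_ ?_ ?_).imp_of_frame fun υ _ hυ => hυ.2
  · simpa [hτ] using hf.hasOutput hσ
  · rintro i hi υ hf' ⟨hstage, hout⟩
    have hwords : υ.arr words = σ.arr words := by rw [hf'.arr _ rfl, hf.arr _ rfl]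
    refine ⟨by simpa [hstage, hf'.reg stages rfl, hf.reg stages rfl, hstages] using hi,
      (runs_emit hout _).seq fun ω hf'' hω => .straight ⟨?_, ?_⟩⟩
    · simp [Prog.apply, hf''.reg stage rfl, hstage]
    · rw [List.range_succ, List.map_append]
      simpa [Prog.apply, State.HasOutput, hwords, hstage] using hω
  · rintro υ hf' ⟨hstage, -⟩
    simp [hstage, hf'.reg stages rfl, hf.reg stages rfl, hstages]

/-- Reads all stages of the guess. -/
def stagesProg : Prog := .loop (.var stage) (.var stages) stageProg

theorem runs_stagesProg {c : ℕ → ℕ → ℕ} {n g k N : ℕ} {w : List ℕ} {σ : State}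
    (hσ : HoldsMatrix c n σ) (hstages : σ.reg stages = k) (h : AtStage c n g w 0 σ) (hn : n ≤ N)
    (hk : k ≤ N) (hg : g ≤ N) : Runs N stagesProg σ (AtStage c n g w k) := by
  refine .loop hk _ h (fun i hi τ hf hτ => ⟨?_, runs_stageProg (hσ.of_frame hf) hτ hn hg⟩)
    fun τ hf hτ => ?_
  · simpa [hτ.stage, hf.reg stages rfl, hstages] using hi
  · simp [hτ.stage, hf.reg stages rfl, hstages]

/-- Writes the triple that the guess encodes. -/
def tripleProg : Prog :=
  emit (.var stages) ;; emit (.lit 0) ;;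
  (.assign code (.var guess) ;; .assign level (.lit 32) ;; .assign need (.var clients + .lit 1) ;;
    .assign current (.lit 0) ;; .assign stage (.lit 0)) ;;
  stagesProg ;; emitWordsProg

theorem runs_tripleProg {n k g N : ℕ} {I : Instance n} {w : List ℕ} {σ : State}
    (hσ : HoldsMatrix I.cost n σ) (hstages : σ.reg stages = k) (hguess : σ.reg guess = g)
    (hout : σ.HasOutput w) (hn : n ≤ N) (hk : k ≤ N) (hg : g ≤ N) :
    Runs N tripleProg σ (·.HasOutput (w ++ (I.decode k g).encode)) := by
  refine (runs_emit hout _).seq fun τ₁ hf₁ hout₁ => (runs_emit hout₁ _).seq fun τ₂ hf₂ hout₂ => ?_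
  rw [Expr.eval_var, hstages] at hout₂
  refine (Runs.straight (Q := AtStage I.cost n g (w ++ [k]) 0) ?_).seq fun τ₃ hf₃ h₃ => ?_
  · have hguess' : τ₂.reg guess = g := by rw [hf₂.reg _ rfl, hf₁.reg _ rfl, hguess]
    have hclients : τ₂.reg clients = n := by rw [hf₂.reg _ rfl, hf₁.reg _ rfl, hσ.clients]
    constructor <;> simp_all [Prog.apply, State.HasOutput, guessAt, scale, word, threshold]
  have hstages₃ : τ₃.reg stages = k := by
    rw [hf₃.reg _ rfl, hf₂.reg _ rfl, hf₁.reg _ rfl, hstages]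
  refine (runs_stagesProg (((hσ.of_frame hf₁).of_frame hf₂).of_frame hf₃) hstages₃ h₃ hn hk hg).seq
    fun τ₄ hf₄ h₄ => (runs_emitWordsProg hk ((hf₄.reg _ rfl).trans hstages₃)
      h₄.output).imp_of_frame fun τ₅ _ h₅ => ?_
  have hwords : (List.range k).map (τ₄.arr words) =
      (List.range k).map fun j => word I.cost n g (j + 1) :=
    List.map_congr_left fun i hi => h₄.words i (List.mem_range.1 hi)
  rw [hwords] at h₅
  rw [Instance.decode, Triple.encode_ofWords]
  simpa using h₅

/-- Writes the triples that all guesses encode. -/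
def listProg : Prog :=
  emit (.var guesses) ;; .assign guess (.lit 0) ;;
  .loop (.var guess) (.var guesses) (tripleProg ;; .assign guess (.var guess + .lit 1))

theorem runs_listProg {n k m N : ℕ} {I : Instance n} {σ : State} (hσ : HoldsMatrix I.cost n σ)
    (hstages : σ.reg stages = k) (hguesses : σ.reg guesses = m) (hout : σ.HasOutput [])
    (hn : n ≤ N) (hk : k ≤ N) (hm : m ≤ N) :
    Runs N listProg σ (·.HasOutput (encodeTriples ((List.range m).map (I.decode k)))) := by
  refine (runs_emit hout _).seq fun τ hf hτ =>
    (Runs.straight (Q := fun υ => υ.reg guess = 0 ∧ υ.HasOutput [m])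
      ⟨by simp [Prog.apply], by simpa [Prog.apply, State.HasOutput, hguesses] using hτ⟩).seq
    fun υ hf' ⟨hguess, hυ⟩ => ?_
  rw [encodeTriples, List.length_map, List.length_range]
  refine (Runs.loop hm (fun i ω => ω.reg guess = i ∧
    ω.HasOutput (m :: ((List.range i).map (I.decode k)).flatMap Triple.encode))
    ⟨hguess, hυ⟩ ?_ ?_).imp_of_frame fun ω _ hω => hω.2
  · rintro i hi ω hf'' ⟨hguess, hω⟩
    have hstages' : ω.reg stages = k := by
      rw [hf''.reg _ rfl, hf'.reg _ rfl, hf.reg _ rfl, hstages]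
    refine ⟨by simpa [hguess, hf''.reg guesses rfl, hf'.reg guesses rfl, hf.reg guesses rfl,
      hguesses] using hi, (runs_tripleProg (((hσ.of_frame hf).of_frame hf').of_frame hf'')
        hstages' hguess hω hn hk (hi.le.trans hm)).seq fun ρ hf₃ hρ => .straight ⟨?_, ?_⟩⟩
    · simp [Prog.apply, hf₃.reg guess rfl, hguess]
    · rw [List.range_succ, List.map_append, List.flatMap_append]
      simpa [Prog.apply, State.HasOutput] using hρ
  · rintro ω hf'' ⟨hguess, -⟩
    simp [hguess, hf''.reg guesses rfl, hf'.reg guesses rfl, hf.reg guesses rfl, hguesses]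

theorem Instance.input_matrix {n m : ℕ} (I : Instance n) (hm : m < (n + 2) * (n + 2)) :
    I.input.arr matrix m = I.cost (m / (n + 2)) (m % (n + 2)) :=
  if_pos ⟨rfl, hm⟩

/-- Computes the offsets of the rows of the matrix. -/
def rowsProg : Prog :=
  .loop (.var index) (.var clients + .lit 2) (
    .store rows (.var index) (.var offset) ;;
    .assign offset (.var offset + (.var clients + .lit 2)) ;;
    .assign index (.var index + .lit 1))

theorem runs_rowsProg {n N : ℕ} (I : Instance n) (hN : n + 2 ≤ N) :
    Runs N rowsProg I.input fun τ => τ.reg offset = (n + 2) * (n + 2) ∧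
      HoldsMatrix I.cost n τ := by
  refine (Runs.loop hN (fun i τ => τ.reg index = i ∧ τ.reg offset = i * (n + 2) ∧
    ∀ a < i, τ.arr rows a = a * (n + 2)) ⟨rfl, (zero_mul _).symm, by simp⟩ ?_ ?_).imp_of_frame ?_
  · rintro i hi τ hf ⟨hindex, hoffset, hrows⟩
    have hclients : τ.reg clients = n := hf.reg _ rfl
    refine ⟨by simpa [hindex, hclients] using hi, .straight ⟨?_, ?_, fun a ha => ?_⟩⟩
    · simp [Prog.apply, hindex]
    · simp [Prog.apply, hoffset, hclients, Nat.succ_mul]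
    · rcases Nat.lt_succ_iff_lt_or_eq.1 ha with ha | rfl
      · simp [Prog.apply, hindex, ha.ne, hrows a ha]
      · simp [Prog.apply, hindex, hoffset]
  · rintro τ hf ⟨hindex, -⟩
    simp [hindex, show τ.reg clients = n from hf.reg _ rfl]
  · rintro τ hf ⟨-, hoffset, hrows⟩
    refine ⟨hoffset, hf.reg _ rfl, fun a ha b hb => ?_⟩
    have hlt : a * (n + 2) + b < (n + 2) * (n + 2) := by nlinarith
    rw [hrows a ha, hf.arr matrix rfl, I.input_matrix hlt, mul_comm a,
      Nat.mul_add_div (by lia), Nat.div_eq_of_lt hb, Nat.mul_add_mod, Nat.mod_eq_of_lt hb,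
      add_zero]

theorem exists_locOf_eq {n : ℕ} (u : Loc n) : ∃ a < n + 2, locOf n a = u := by
  cases u with
  | client v => exact ⟨v, by lia, by simp [locOf]⟩
  | source => exact ⟨n, by lia, by simp [locOf]⟩
  | target => exact ⟨n + 1, by lia, by simp [locOf]⟩

theorem Instance.c_le_maxCost {n : ℕ} (I : Instance n) (u v : Loc n) : I.c u v ≤ I.maxCost :=
  (Finset.le_sup (f := I.c u) (Finset.mem_univ v)).trans
    (Finset.le_sup (f := fun u => Finset.univ.sup (I.c u)) (Finset.mem_univ u))

theorem Instance.sup_cost_eq_maxCost {n : ℕ} (I : Instance n) :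
    ((Finset.range ((n + 2) * (n + 2))).sup fun m => I.cost (m / (n + 2)) (m % (n + 2))) =
      I.maxCost := by
  refine le_antisymm (Finset.sup_le fun m _ => I.c_le_maxCost _ _)
    (Finset.sup_le fun u _ => Finset.sup_le fun v _ => ?_)
  obtain ⟨a, ha, rfl⟩ := exists_locOf_eq u
  obtain ⟨b, hb, rfl⟩ := exists_locOf_eq v
  have hlt : (n + 2) * a + b < (n + 2) * (n + 2) := by nlinarith
  have hle := Finset.le_sup (f := fun m => I.cost (m / (n + 2)) (m % (n + 2)))
    (Finset.mem_range.2 hlt)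
  rwa [Nat.mul_add_div (by lia), Nat.div_eq_of_lt hb, Nat.mul_add_mod, Nat.mod_eq_of_lt hb,
    add_zero] at hle

/-- Computes the largest distance. -/
def maxProg : Prog :=
  .assign index (.lit 0) ;;
  .loop (.var index) (.var offset) (
    .assign reach (.var reach + (.load matrix (.var index) - .var reach)) ;;
    .assign index (.var index + .lit 1))

theorem runs_maxProg {n N : ℕ} {I : Instance n} {σ : State} (hN : (n + 2) * (n + 2) ≤ N)
    (hmatrix : σ.arr matrix = I.input.arr matrix) (hoffset : σ.reg offset = (n + 2) * (n + 2))
    (hreach : σ.reg reach = 0) : Runs N maxProg σ fun τ => τ.reg reach = I.maxCost := by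
  refine (Runs.straight (Q := (·.reg index = 0)) (by simp [Prog.apply])).seq fun τ hf hτ => ?_
  refine (Runs.loop hN (fun i υ => υ.reg index = i ∧ υ.reg reach =
    (Finset.range i).sup fun m => I.cost (m / (n + 2)) (m % (n + 2)))
    ⟨hτ, (hf.reg _ rfl).trans hreach⟩ ?_ ?_).imp_of_frame
      fun υ _ hυ => hυ.2.trans I.sup_cost_eq_maxCost
  · rintro i hi υ hf' ⟨hindex, hsup⟩
    have hcell : υ.arr matrix i = I.cost (i / (n + 2)) (i % (n + 2)) := by
      rw [hf'.arr _ rfl, hf.arr _ rfl, hmatrix, I.input_matrix hi]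
    refine ⟨by simpa [hindex, hf'.reg offset rfl, hf.reg offset rfl, hoffset] using hi,
      .straight ⟨by simp [Prog.apply, hindex], ?_⟩⟩
    rw [Finset.range_add_one, Finset.sup_insert, ← hcell, ← hsup]
    simp [Prog.apply, hindex, add_tsub_eq_max, sup_comm]
  · rintro υ hf' ⟨hindex, -⟩
    simp [hindex, hf'.reg offset rfl, hf.reg offset rfl, hoffset]

/-- Computes the number `k` of stages, and multiplies the reach by `2 ^ k`. -/
def sizeProg : Prog :=
  (.assign guesses (.lit 1) ;; .assign index (.var clients + .lit 1)) ;;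
  .loop (.lit 1) (.var index) (
    .assign stages (.var stages + .lit 1) ;;
    .assign reach (.var reach + .var reach) ;;
    .assign guesses (.var guesses + .var guesses) ;;
    .assign guesses (.var guesses + .var guesses) ;;
    .assign index (.half (.var index)))

theorem runs_sizeProg {n k N : ℕ} {σ : State} (hk : n + 1 = 2 ^ k) (hN : k ≤ N)
    (hclients : σ.reg clients = n) (hstages : σ.reg stages = 0) :
    Runs N sizeProg σ fun τ =>
      τ.reg stages = k ∧ τ.reg reach = σ.reg reach * 2 ^ k ∧ τ.reg guesses = 4 ^ k := by
  refine (Runs.straight (Q := fun τ => τ.reg guesses = 1 ∧ τ.reg index = 2 ^ k)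
    (by simp [Prog.apply, hclients, hk])).seq fun τ hf ⟨hguesses, hindex⟩ => ?_
  refine (Runs.loop hN (fun i υ => υ.reg index = 2 ^ (k - i) ∧ υ.reg stages = i ∧
    υ.reg reach = σ.reg reach * 2 ^ i ∧ υ.reg guesses = 4 ^ i)
    ⟨hindex, (hf.reg _ rfl).trans hstages, by simp [hf.reg reach rfl], hguesses⟩
    ?_ ?_).imp_of_frame fun υ _ hυ => hυ.2
  · rintro i hi υ - ⟨hindex, hstages, hreach, hguesses⟩
    obtain ⟨d, hd⟩ : ∃ d, k - i = d + 1 := ⟨k - i - 1, by lia⟩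
    have hd' : k - (i + 1) = d := by lia
    rw [hd, pow_succ] at hindex
    refine ⟨?_, .straight ⟨?_, ?_, ?_, ?_⟩⟩
    · have := Nat.two_pow_pos d
      simp only [hindex, Expr.eval_lit, Expr.eval_var]
      lia
    · simp [Prog.apply, hindex, hd']
    · simp [Prog.apply, hstages]
    · simp [Prog.apply, hreach, pow_succ, mul_two, mul_add]
    · have hfour : 4 ^ (i + 1) = 4 ^ i + 4 ^ i + (4 ^ i + 4 ^ i) := by ring
      simp [Prog.apply, hguesses, hfour]
  · rintro υ - ⟨hindex, -⟩
    simp [hindex]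

theorem add_le_grow_iterate {s : ℕ} (hs : 32 ≤ s) (i : ℕ) : s + i ≤ grow^[i] s := by
  induction i with
  | zero => rfl
  | succ i ih =>
    rw [Function.iterate_succ_apply', grow]
    lia

/-- The number of times the scale `s` has to be increased until it is at least `32 B`. It is meant
for `32 ≤ s`, as smaller scales do not increase. -/
noncomputable def skipsTo (s B : ℕ) : ℕ := sInf {i | B ≤ grow^[i] s / 32}

theorem le_of_skipsTo {s : ℕ} (hs : 32 ≤ s) (B : ℕ) : B ≤ grow^[skipsTo s B] s / 32 := by
  have hmem : 32 * B ∈ {i | B ≤ grow^[i] s / 32} := by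
    have := add_le_grow_iterate hs (32 * B)
    rw [Set.mem_ofPred_eq]
    lia
  exact Nat.sInf_mem ⟨_, hmem⟩

theorem lt_of_lt_skipsTo {s B i : ℕ} (hi : i < skipsTo s B) : grow^[i] s / 32 < B :=
  not_le.1 (Nat.notMem_of_lt_sInf (s := {i | B ≤ grow^[i] s / 32}) hi)

/-- Multiplies the number of guesses by `2 ^ skipsTo 32 B`, where `B` is the reach. -/
def skipProg : Prog :=
  .assign level (.lit 32) ;;
  .loop (.div32 (.var level)) (.var reach) (
    .assign level (.var level + .div32 (.var level)) ;;
    .assign guesses (.var guesses + .var guesses))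

theorem runs_skipProg {N : ℕ} {σ : State} (hN : skipsTo 32 (σ.reg reach) ≤ N) :
    Runs N skipProg σ fun τ =>
      τ.reg guesses = 2 ^ skipsTo 32 (σ.reg reach) * σ.reg guesses := by
  refine (Runs.straight (Q := (·.reg level = 32)) (by simp [Prog.apply])).seq fun τ hf hτ => ?_
  refine (Runs.loop hN (fun i υ => υ.reg level = grow^[i] 32 ∧
    υ.reg guesses = 2 ^ i * σ.reg guesses) ⟨hτ, by simp [hf.reg guesses rfl]⟩
    ?_ ?_).imp_of_frame fun υ _ hυ => hυ.2
  · rintro i hi υ hf' ⟨hlevel, hguesses⟩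
    refine ⟨by simpa [hlevel, hf'.reg reach rfl, hf.reg reach rfl] using lt_of_lt_skipsTo hi,
      .straight ⟨?_, ?_⟩⟩
    · simp [Prog.apply, hlevel, Function.iterate_succ_apply', grow]
    · simp [Prog.apply, hguesses, pow_succ, mul_two, add_mul]
  · rintro υ hf' ⟨hlevel, -⟩
    simpa [hlevel, hf'.reg reach rfl, hf.reg reach rfl] using le_of_skipsTo le_rfl _

/-- The program that lists the triples. -/
def latencyProg : Prog := rowsProg ;; maxProg ;; sizeProg ;; skipProg ;; listProg

namespace Instance

variable {n : ℕ} (I : Instance n)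

/-- A bound on all thresholds that have to be considered if there are `2 ^ k - 1` clients. -/
def reach (k : ℕ) : ℕ := I.maxCost * 2 ^ k

/-- The number of guesses that are tried if there are `2 ^ k - 1` clients. -/
noncomputable def guessCount (k : ℕ) : ℕ := 2 ^ skipsTo 32 (I.reach k) * 4 ^ k

/-- The triples that the algorithm lists. -/
noncomputable def triples (k : ℕ) : List (Triple n) :=
  (List.range (I.guessCount k)).map (I.decode k)

/-- A bound on the number of iterations of each loop. -/
noncomputable def loopBound (k : ℕ) : ℕ := (n + 2) * (n + 2) + I.guessCount k

theorem runs_latencyProg {k : ℕ} (hk : n + 1 = 2 ^ k) :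
    Runs (I.loopBound k) latencyProg I.input (·.HasOutput (encodeTriples (I.triples k))) := by
  have hG : I.guessCount k ≤ I.loopBound k := Nat.le_add_left _ _
  have hn : (n + 2) * (n + 2) ≤ I.loopBound k := Nat.le_add_right _ _
  have hn' : n + 2 ≤ I.loopBound k := (Nat.le_mul_self _).trans hn
  have hkn : k < n + 1 := hk ▸ Nat.lt_two_pow_self
  have hskip : skipsTo 32 (I.reach k) ≤ I.loopBound k :=
    (Nat.lt_two_pow_self.le.trans (Nat.le_mul_of_pos_right _ (by positivity))).trans hG
  refine (runs_rowsProg I hn').seq fun τ₁ hf₁ ⟨hoffset, h₁⟩ =>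
    (runs_maxProg hn (hf₁.arr _ rfl) hoffset (hf₁.reg _ rfl)).seq fun τ₂ hf₂ hmax =>
    (runs_sizeProg hk (by lia) (h₁.of_frame hf₂).clients
      ((hf₂.reg _ rfl).trans (hf₁.reg _ rfl))).seq fun τ₃ hf₃ ⟨hstages, hreach, hguesses⟩ => ?_
  rw [hmax, ← reach] at hreach
  refine (runs_skipProg (hreach ▸ hskip)).seq fun τ₄ hf₄ h₄ => ?_
  rw [hreach, hguesses] at h₄
  refine runs_listProg (((h₁.of_frame hf₂).of_frame hf₃).of_frame hf₄)
    ((hf₄.reg _ rfl).trans hstages) h₄ ⟨?_, by simp⟩ (by lia) (by lia) hG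
  rw [hf₄.reg _ rfl, hf₃.reg _ rfl, hf₂.reg _ rfl, hf₁.reg _ rfl]
  rfl

end Instance

end DirLat

namespace DirLat

/-! ## Polynomial bounds -/

variable {n : ℕ}

theorem two_pow_le_grow_iterate_pow (i : ℕ) : 2 ^ i ≤ (grow^[i] 32) ^ 64 := by
  induction i with
  | zero => exact Nat.one_le_pow 64 32 (by norm_num)
  | succ i ih =>
    rw [Function.iterate_succ_apply']
    set s := grow^[i] 32
    have hs : 32 ≤ s := le_grow_iterate i 32
    have hgrow : (65 * s) ^ 64 ≤ (64 * grow s) ^ 64 :=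
      Nat.pow_le_pow_left (by unfold grow; lia) 64
    rw [mul_pow, mul_pow] at hgrow
    have hdouble : 64 ^ 64 * (2 * s ^ 64) ≤ 64 ^ 64 * grow s ^ 64 := by
      refine le_trans ?_ hgrow
      rw [← mul_assoc]
      exact Nat.mul_le_mul_right _ (by norm_num)
    rw [pow_succ']
    exact (Nat.mul_le_mul_left 2 ih).trans (Nat.le_of_mul_le_mul_left hdouble (by positivity))

theorem two_pow_skipsTo_le (B : ℕ) : 2 ^ skipsTo 32 B ≤ 2 * (32 * B) ^ 64 + 1 := by
  rcases h : skipsTo 32 B with _ | i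
  · exact Nat.le_add_left _ _
  · have hlt := lt_of_lt_skipsTo (i.lt_succ_self.trans_eq h.symm)
    calc 2 ^ (i + 1) = 2 * 2 ^ i := pow_succ' 2 i
      _ ≤ 2 * (grow^[i] 32) ^ 64 := Nat.mul_le_mul_left 2 (two_pow_le_grow_iterate_pow i)
      _ ≤ 2 * (32 * B) ^ 64 :=
        Nat.mul_le_mul_left 2 (Nat.pow_le_pow_left (by lia) 64)
      _ ≤ _ := Nat.le_succ _

namespace Instance

variable {I : Instance n}

theorem guessCount_le {k : ℕ} (hk : n + 1 = 2 ^ k) :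
    I.guessCount k ≤ (2 * (32 * (I.maxCost * (n + 1))) ^ 64 + 1) * (n + 1) ^ 2 := by
  have hfour : 4 ^ k = (n + 1) ^ 2 := by rw [hk, ← pow_mul, mul_comm, pow_mul]; norm_num
  rw [guessCount, reach, ← hk, hfour]
  exact Nat.mul_le_mul_right _ (two_pow_skipsTo_le _)

theorem IsNice.maxCost_le {ε : ℝ} (h : I.IsNice ε) (hε : 0 < ε) :
    (I.maxCost : ℝ) ≤ 2 * ((n : ℝ) + 1 / ε + 1) ^ 7 := by
  have hinv : 0 < 1 / ε := one_div_pos.2 hε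
  set X := (n : ℝ) + 1 / ε + 1
  have hn : (n : ℝ) ≤ X := by linarith
  have hε' : 1 / ε ≤ X := by have := n.cast_nonneg (α := ℝ); linarith
  have hX : 0 ≤ 2 * X ^ 7 := by positivity
  have key (u v : Loc n) : (I.c u v : ℝ) ≤ 2 * X ^ 7 := by
    by_cases huv : u = v
    · rwa [huv, I.c_self, Nat.cast_zero]
    · calc (I.c u v : ℝ) ≤ 2 * (n : ℝ) ^ 5 / ε ^ 2 := (h.2 u v huv).2
        _ = 2 * ((n : ℝ) ^ 5 * (1 / ε) ^ 2) := by rw [one_div, inv_pow]; ring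
        _ ≤ 2 * (X ^ 5 * X ^ 2) := by gcongr
        _ = 2 * X ^ 7 := by ring
  exact (Nat.cast_le.2 (Finset.sup_le fun u _ => Finset.sup_le fun v _ =>
    Nat.le_floor (key u v))).trans (Nat.floor_le hX)

theorem IsNice.loopBound_le {ε : ℝ} (h : I.IsNice ε) (hε : 0 < ε) {k : ℕ} (hk : n + 1 = 2 ^ k) :
    (I.loopBound k : ℝ) + 1 ≤ 8 * 64 ^ 64 * ((n : ℝ) + 1 / ε + 1) ^ 514 := by
  have hmax := h.maxCost_le hε
  have hinv : 0 < 1 / ε := one_div_pos.2 hε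
  generalize hdef : (n : ℝ) + 1 / ε + 1 = X at hmax ⊢
  have hn : (n : ℝ) + 1 ≤ X := by linarith
  have hX : 1 ≤ X := by have := n.cast_nonneg (α := ℝ); linarith
  have hsquare : ((n : ℝ) + 2) * (n + 2) + 1 ≤ 5 * X ^ 2 := by nlinarith
  have hguess : (I.guessCount k : ℝ) ≤ (2 * (32 * (2 * X ^ 7 * X)) ^ 64 + 1) * X ^ 2 :=
    calc (I.guessCount k : ℝ)
        ≤ (2 * (32 * (I.maxCost * (n + 1))) ^ 64 + 1) * (n + 1) ^ 2 := by
          exact_mod_cast guessCount_le hk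
      _ ≤ _ := by gcongr
  have hone : 1 ≤ (32 * (2 * X ^ 7 * X)) ^ 64 :=
    one_le_pow₀ (by nlinarith [one_le_pow₀ hX (n := 7)])
  calc (I.loopBound k : ℝ) + 1 = ((n : ℝ) + 2) * (n + 2) + 1 + I.guessCount k := by
        rw [loopBound]
        push_cast
        ring
    _ ≤ 5 * X ^ 2 + (2 * (32 * (2 * X ^ 7 * X)) ^ 64 + 1) * X ^ 2 := add_le_add hsquare hguess
    _ = (2 * (32 * (2 * X ^ 7 * X)) ^ 64 + 6 * 1) * X ^ 2 := by ring
    _ ≤ (2 * (32 * (2 * X ^ 7 * X)) ^ 64 + 6 * (32 * (2 * X ^ 7 * X)) ^ 64) * X ^ 2 := by gcongr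
    _ = 8 * 64 ^ 64 * X ^ 514 := by ring

end Instance

/-! ## Walks as solutions of the linear program -/

/-- The vertices `P 0, …, P (N + 1)` form a walk through the time-indexed graph from `(s, 0)` to
`(s', T + 1)`, on which time increases and which visits client `v` exactly once, at time `τ v`. -/
structure IsWalk (I : Instance n) (R : Finset (Fin n)) (T N : ℕ) (P : ℕ → Site n × ℕ)
    (τ : Fin n → ℕ) : Prop where
  start : P 0 = (.source, 0)
  finish : P (N + 1) = (.target, T + 1)
  lt : ∀ i ≤ N, (P i).2 < (P (i + 1)).2
  dist : ∀ i ≤ N, (P i).2 + I.c (P i).1.loc (P (i + 1)).1.loc ≤ (P (i + 1)).2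
  mem : ∀ i, 0 < i → i ≤ N → (∃ v, (P i).1 = .client v) ∨ ∃ r ∈ R, (P i).1 = .root r
  visit : ∀ v, ∃ i, 0 < i ∧ i ≤ N ∧ P i = (.client v, τ v)
  unique : ∀ i, 0 < i → i ≤ N → ∀ v t, P i = (.client v, t) → t = τ v

/-- The number of visits of the walk `P 0, …, P (N + 1)` to a vertex, not counting its end. -/
def walkVisits (N : ℕ) (P : ℕ → Site n × ℕ) (p : Site n × ℕ) : ℝ :=
  ∑ i ∈ Finset.range (N + 1), if P i = p then 1 else 0

/-- The number of traversals of an edge by the walk `P 0, …, P (N + 1)`. -/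
def walkFlow (N : ℕ) (P : ℕ → Site n × ℕ) (e : TimeEdge n) : ℝ :=
  ∑ i ∈ Finset.range (N + 1), if (P i, P (i + 1)) = e then 1 else 0

theorem walkVisits_nonneg (N : ℕ) (P : ℕ → Site n × ℕ) (p : Site n × ℕ) : 0 ≤ walkVisits N P p :=
  Finset.sum_nonneg fun _ _ => by positivity

theorem walkFlow_nonneg (N : ℕ) (P : ℕ → Site n × ℕ) (e : TimeEdge n) : 0 ≤ walkFlow N P e :=
  Finset.sum_nonneg fun _ _ => by positivity

theorem walkFlow_le_walkVisits (N : ℕ) (P : ℕ → Site n × ℕ) (e : TimeEdge n) :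
    walkFlow N P e ≤ walkVisits N P e.1 := by
  refine Finset.sum_le_sum fun i _ => ?_
  split_ifs with h h'
  · rfl
  · exact absurd (congrArg Prod.fst h) h'
  · exact zero_le_one
  · rfl

theorem sum_walkFlow (N : ℕ) (P : ℕ → Site n × ℕ) (E : Finset (TimeEdge n)) :
    ∑ e ∈ E, walkFlow N P e =
      ∑ i ∈ Finset.range (N + 1), if (P i, P (i + 1)) ∈ E then 1 else 0 := by
  simp only [walkFlow]
  rw [Finset.sum_comm]
  simp only [Finset.sum_ite_eq]

theorem one_le_walkFlow {N i : ℕ} (P : ℕ → Site n × ℕ) (hi : i ≤ N) :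
    1 ≤ walkFlow N P (P i, P (i + 1)) := by
  have := Finset.single_le_sum
    (f := fun j => if (P j, P (j + 1)) = (P i, P (i + 1)) then (1 : ℝ) else 0)
    (fun _ _ => by positivity) (Finset.mem_range.2 (Nat.lt_succ_of_le hi))
  simpa only [walkFlow, if_true] using this

theorem sum_succ_eq_walkVisits {N : ℕ} {P : ℕ → Site n × ℕ} {p : Site n × ℕ} (h0 : P 0 ≠ p)
    (hN : P (N + 1) ≠ p) :
    (∑ i ∈ Finset.range (N + 1), if P (i + 1) = p then 1 else 0) = walkVisits N P p := by
  have h := (Finset.sum_range_succ' (fun i => if P i = p then (1 : ℝ) else 0) (N + 1)).symm.trans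
    (Finset.sum_range_succ (fun i => if P i = p then (1 : ℝ) else 0) (N + 1))
  simpa only [walkVisits, if_neg h0, if_neg hN, add_zero] using h

theorem exists_lt_not_and_succ {p : ℕ → Prop} {j : ℕ} (h0 : ¬ p 0) (hj : p j) :
    ∃ i < j, ¬ p i ∧ p (i + 1) := by
  by_contra! h
  have hnot : ∀ i ≤ j, ¬ p i := fun i => by
    induction i with
    | zero => exact fun _ => h0
    | succ i ih => exact fun hi => h i hi (ih (Nat.le_of_succ_le hi))
  exact hnot j le_rfl hj

namespace IsWalk

variable {I : Instance n} {R : Finset (Fin n)} {T N : ℕ} {P : ℕ → Site n × ℕ} {τ : Fin n → ℕ}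

theorem time_lt (h : IsWalk I R T N P τ) {i j : ℕ} (hij : i < j) (hj : j ≤ N + 1) :
    (P i).2 < (P j).2 := by
  induction j, hij using Nat.le_induction with
  | base => exact h.lt i (by lia)
  | succ j _ ih => exact (ih (by lia)).trans (h.lt j (by lia))

theorem inj (h : IsWalk I R T N P τ) {i j : ℕ} (hi : i ≤ N + 1) (hj : j ≤ N + 1)
    (hij : P i = P j) : i = j := by
  rcases lt_trichotomy i j with hlt | heq | hlt
  · exact absurd (congrArg Prod.snd hij) (h.time_lt hlt hj).ne
  · exact heq
  · exact absurd (congrArg Prod.snd hij) (h.time_lt hlt hi).ne'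

theorem time_mem (h : IsWalk I R T N P τ) {i : ℕ} (h0 : 0 < i) (hi : i ≤ N) :
    (P i).2 ∈ Finset.Icc 1 T := by
  have hstart := h.time_lt h0 (by lia)
  have hfinish := h.time_lt (Nat.lt_succ_of_le hi) le_rfl
  rw [h.start] at hstart
  rw [h.finish] at hfinish
  exact Finset.mem_Icc.2 ⟨hstart, Nat.le_of_lt_succ hfinish⟩

theorem visit_time_mem (h : IsWalk I R T N P τ) (v : Fin n) : τ v ∈ Finset.Icc 1 T := by
  obtain ⟨i, h0, hi, hP⟩ := h.visit v
  simpa only [hP] using h.time_mem h0 hi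

theorem mem_timeVertices (h : IsWalk I R T N P τ) {i : ℕ} (hi : i ≤ N + 1) :
    P i ∈ timeVertices R T := by
  rw [timeVertices, Finset.mem_union]
  rcases i.eq_zero_or_pos with rfl | h0
  · simp [h.start]
  rcases hi.eq_or_lt with rfl | hlt
  · simp [h.finish]
  refine .inl (Finset.mem_product.2 ⟨?_, h.time_mem h0 (by lia)⟩)
  rcases h.mem i h0 (by lia) with ⟨v, hv⟩ | ⟨r, hr, hv⟩
  · simp [hv]
  · simp [hv, hr]

theorem edge_mem (h : IsWalk I R T N P τ) {i : ℕ} (hi : i ≤ N) :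
    (P i, P (i + 1)) ∈ I.timeEdges R T :=
  Finset.mem_filter.2
    ⟨Finset.mem_product.2 ⟨h.mem_timeVertices (by lia), h.mem_timeVertices (by lia)⟩,
      fun heq => (h.lt i hi).ne (congrArg Prod.snd heq), h.dist i hi⟩

theorem walkVisits_eq_one (h : IsWalk I R T N P τ) {i : ℕ} (hi : i ≤ N) :
    walkVisits N P (P i) = 1 := by
  rw [walkVisits, Finset.sum_eq_single i]
  · exact if_pos rfl
  · exact fun j hj hne => if_neg fun heq =>
      hne (h.inj (Finset.mem_range.1 hj).le (Nat.le_succ_of_le hi) heq)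
  · exact fun hnot => absurd (Finset.mem_range.2 (Nat.lt_succ_of_le hi)) hnot

theorem walkVisits_le_one (h : IsWalk I R T N P τ) (p : Site n × ℕ) : walkVisits N P p ≤ 1 := by
  by_cases hp : ∃ i ≤ N, P i = p
  · obtain ⟨i, hi, rfl⟩ := hp
    exact (h.walkVisits_eq_one hi).le
  · refine (Finset.sum_eq_zero fun i hi => if_neg fun heq => hp ⟨i, ?_, heq⟩).trans_le zero_le_one
    exact Nat.le_of_lt_succ (Finset.mem_range.1 hi)

theorem walkVisits_client (h : IsWalk I R T N P τ) (v : Fin n) (t : ℕ) :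
    walkVisits N P (.client v, t) = if t = τ v then 1 else 0 := by
  split_ifs with ht
  · obtain ⟨i, -, hi, hP⟩ := h.visit v
    rw [ht, ← hP, h.walkVisits_eq_one hi]
  · refine Finset.sum_eq_zero fun i hi => if_neg fun heq => ht ?_
    rcases i.eq_zero_or_pos with rfl | h0
    · cases h.start.symm.trans heq
    · exact h.unique i h0 (Nat.le_of_lt_succ (Finset.mem_range.1 hi)) v t heq

theorem sum_walkVisits_client (h : IsWalk I R T N P τ) (v : Fin n) (S : Finset ℕ) :
    ∑ t ∈ S, walkVisits N P (.client v, t) = if τ v ∈ S then 1 else 0 := by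
  simp only [h.walkVisits_client, Finset.sum_ite_eq']

theorem sum_outEdges (h : IsWalk I R T N P τ) (p : Site n × ℕ) :
    ∑ e ∈ I.outEdges R T p, walkFlow N P e = walkVisits N P p := by
  rw [sum_walkFlow]
  refine Finset.sum_congr rfl fun i hi => ?_
  simp only [Instance.outEdges, Finset.mem_filter,
    h.edge_mem (Nat.le_of_lt_succ (Finset.mem_range.1 hi)), true_and]

theorem sum_inEdges_eq_sum (h : IsWalk I R T N P τ) (p : Site n × ℕ) :
    ∑ e ∈ I.inEdges R T p, walkFlow N P e =
      ∑ i ∈ Finset.range (N + 1), if P (i + 1) = p then 1 else 0 := by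
  rw [sum_walkFlow]
  refine Finset.sum_congr rfl fun i hi => ?_
  simp only [Instance.inEdges, Finset.mem_filter,
    h.edge_mem (Nat.le_of_lt_succ (Finset.mem_range.1 hi)), true_and]

theorem sum_inEdges (h : IsWalk I R T N P τ) {p : Site n × ℕ} (hs : p.1 ≠ .source)
    (ht : p.1 ≠ .target) : ∑ e ∈ I.inEdges R T p, walkFlow N P e = walkVisits N P p := by
  rw [h.sum_inEdges_eq_sum, sum_succ_eq_walkVisits]
  · rintro rfl
    exact hs (congrArg Prod.fst h.start)
  · rintro rfl
    exact ht (congrArg Prod.fst h.finish)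

theorem sum_inEdges_target (h : IsWalk I R T N P τ) :
    ∑ e ∈ I.inEdges R T (.target, T + 1), walkFlow N P e = 1 := by
  rw [h.sum_inEdges_eq_sum, ← h.finish, Finset.sum_eq_single N]
  · exact if_pos rfl
  · exact fun i hi hne => if_neg fun heq =>
      hne (Nat.succ_injective (h.inj (Finset.mem_range.1 hi) le_rfl heq))
  · exact fun hnot => absurd (Finset.self_mem_range_succ N) hnot

theorem exists_first_entering (h : IsWalk I R T N P τ) {S : Finset (Site n)}
    (hS : .source ∉ S) {v : Fin n} (hv : .client v ∈ S) :
    ∃ i ≤ N, (P i).1 ∉ S ∧ (P (i + 1)).1 ∈ S ∧ (P (i + 1)).2 ≤ τ v := by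
  obtain ⟨j, -, hj, hP⟩ := h.visit v
  have hjS : (P j).1 ∈ S := by rwa [hP]
  obtain ⟨i, hij, hi, hmin⟩ := exists_lt_not_and_succ (p := fun i => (P i).1 ∈ S)
    (by rwa [h.start]) hjS
  refine ⟨i, by lia, hi, hmin, ?_⟩
  rcases (Nat.succ_le_of_lt hij).eq_or_lt with heq | hlt
  · rw [show i + 1 = j from heq, hP]
  · simpa only [hP] using (h.time_lt hlt (by lia)).le

theorem cut (h : IsWalk I R T N P τ) {S : Finset (Site n)} (hS : .source ∉ S) {v : Fin n}
    (hv : .client v ∈ S) (t : ℕ) :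
    ∑ t' ∈ Finset.Icc 1 t, walkVisits N P (.client v, t') ≤
      ∑ t' ∈ Finset.Icc 1 t, ∑ e ∈ I.entering R T S t', walkFlow N P e := by
  have hnonneg : ∀ t' ∈ Finset.Icc 1 t, 0 ≤ ∑ e ∈ I.entering R T S t', walkFlow N P e :=
    fun t' _ => Finset.sum_nonneg fun e _ => walkFlow_nonneg N P e
  rw [h.sum_walkVisits_client]
  split_ifs with hτ
  swap
  · exact Finset.sum_nonneg hnonneg
  obtain ⟨i, hi, hout, hin, hle⟩ := h.exists_first_entering hS hv
  have htime : (P (i + 1)).2 ∈ Finset.Icc 1 t :=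
    Finset.mem_Icc.2 ⟨(Nat.zero_le _).trans_lt (h.lt i hi), hle.trans (Finset.mem_Icc.1 hτ).2⟩
  have hmem : (P i, P (i + 1)) ∈ I.entering R T S (P (i + 1)).2 :=
    Finset.mem_filter.2 ⟨h.edge_mem hi, hout, hin, rfl⟩
  calc (1 : ℝ) ≤ walkFlow N P (P i, P (i + 1)) := one_le_walkFlow P hi
    _ ≤ ∑ e ∈ I.entering R T S (P (i + 1)).2, walkFlow N P e :=
      Finset.single_le_sum (fun e _ => walkFlow_nonneg N P e) hmem
    _ ≤ _ := Finset.single_le_sum hnonneg htime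

theorem inPolytope (h : IsWalk I R T N P τ) :
    I.InPolytope R T (walkVisits N P) (walkFlow N P) where
  x_mem p _ := ⟨walkVisits_nonneg N P p, h.walkVisits_le_one p⟩
  z_mem e _ := ⟨walkFlow_nonneg N P e,
    (walkFlow_le_walkVisits N P e).trans (h.walkVisits_le_one e.1)⟩
  visit v := by rw [h.sum_walkVisits_client, if_pos (h.visit_time_mem v)]
  flow_out v t _ := h.sum_outEdges _
  flow_in v t _ := h.sum_inEdges nofun nofun
  flow_source := by rw [h.sum_outEdges, ← h.start, h.walkVisits_eq_one N.zero_le]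
  flow_target := h.sum_inEdges_target
  cut S hS v hv t _ := h.cut (fun hs => by simpa using hS _ hs) hv t

theorem isFeasible {G : Triple n} (h : IsWalk I G.roots (I.horizon G) N P τ)
    (hforb : ∀ i ≤ N, ¬ G.Forbidden (P i, P (i + 1)))
    (hwithin : ∀ v, τ v < G.t (Fin.last G.q))
    (hord : ∀ (u v : Fin n) (i j : Fin G.q), (j : ℕ) = i + 1 → τ u ∉ G.tourTimes →
      τ v ∉ G.tourTimes → τ u < G.t i.succ → G.t i.succ ≤ τ v → I.IsShort u v (G.t j.succ)) :
    I.IsFeasible G (walkVisits N P) (walkFlow N P) where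
  mem_polytope := h.inPolytope
  within v t _ ht := by rw [h.walkVisits_client, if_neg ((hwithin v).trans_le ht).ne']
  root_flow r _ t _ := (h.sum_inEdges (p := (.root r, t)) nofun nofun).trans (h.sum_outEdges _).symm
  forbidden e _ he := Finset.sum_eq_zero fun i hi => if_neg (by
    rintro rfl
    exact hforb i (Nat.le_of_lt_succ (Finset.mem_range.1 hi)) he)
  ordering u v i j hij hshort := by
    have hu := h.visit_time_mem u
    have hv := h.visit_time_mem v
    rw [Finset.sum_sub_distrib, Finset.sum_add_distrib]
    simp only [h.sum_walkVisits_client, Finset.mem_inter, hu, hv, true_and, Finset.mem_Ico,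
      (Finset.mem_Icc.1 hu).1, (Finset.mem_Icc.1 hv).1]
    by_cases hbefore : τ u < G.t i.succ ∧ G.t i.succ ≤ τ v
    · have htour : τ u ∈ G.tourTimes ∨ τ v ∈ G.tourTimes := by
        by_contra! hnot
        exact hshort (hord u v i j hij hnot.1 hnot.2 hbefore.1 hbefore.2)
      rcases htour with hmem | hmem <;> simp only [hmem, if_true] <;> split_ifs <;> norm_num
    · rw [not_and, not_le] at hbefore
      by_cases hlt : τ u < G.t i.succ
      · simp only [hlt, hbefore hlt, if_true, sub_self]
        positivity
      · simp only [hlt, if_false, zero_sub]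
        exact (neg_nonpos.2 (by positivity)).trans (by positivity)

theorem lpCost_eq {G : Triple n} (h : IsWalk I G.roots (I.horizon G) N P τ) :
    I.lpCost G (walkVisits N P) =
      ∑ v, ∑ i : Fin G.q, if τ v ∈ G.interval i then (G.t i.succ : ℝ) else 0 := by
  refine Finset.sum_congr rfl fun v _ => Finset.sum_congr rfl fun i _ => ?_
  rw [← Finset.mul_sum, h.sum_walkVisits_client]
  simp only [Finset.mem_inter, h.visit_time_mem v, true_and, mul_ite, mul_one, mul_zero]

end IsWalk

/-- A step from `x` to `y`: time increases by at least the distance, and the edge is not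
forbidden. -/
structure IsStep (I : Instance n) (G : Triple n) (x y : Site n × ℕ) : Prop where
  lt : x.2 < y.2
  dist : x.2 + I.c x.1.loc y.1.loc ≤ y.2
  not_forbidden : ¬ G.Forbidden (x, y)

theorem exists_isWalk {I : Instance n} {G : Triple n} {τ : Fin n → ℕ} {L : List (Site n × ℕ)}
    (hchain : ((.source, 0) :: (L ++ [(.target, I.horizon G + 1)])).IsChain (IsStep I G))
    (hmem : ∀ x ∈ L, (∃ v, x.1 = .client v) ∨ ∃ r ∈ G.roots, x.1 = .root r)
    (hvisit : ∀ v, (.client v, τ v) ∈ L) (hunique : ∀ v t, (.client v, t) ∈ L → t = τ v) :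
    ∃ N P, IsWalk I G.roots (I.horizon G) N P τ ∧ ∀ i ≤ N, ¬ G.Forbidden (P i, P (i + 1)) := by
  set W : List (Site n × ℕ) := (.source, 0) :: (L ++ [(.target, I.horizon G + 1)]) with hW
  have hlen : W.length = L.length + 2 := by simp [hW]
  set P : ℕ → Site n × ℕ := fun i => W.getD i (.source, 0) with hP
  have hstep : ∀ i ≤ L.length, IsStep I G (P i) (P (i + 1)) := fun i hi => by
    simp only [hP, List.getD_eq_getElem _ _ (show i < W.length by lia),
      List.getD_eq_getElem _ _ (show i + 1 < W.length by lia)]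
    exact List.isChain_iff_getElem.1 hchain i (by lia)
  have hinner : ∀ (i : ℕ) (hi : i < L.length), P (i + 1) = L[i] := fun i hi => by
    simp only [hP, hW, List.getD_cons_succ, List.getD_append _ _ _ _ hi,
      List.getD_eq_getElem _ _ hi]
  have hmemL : ∀ i, 0 < i → i ≤ L.length → P i ∈ L := fun i h0 hi => by
    obtain ⟨i, rfl⟩ := Nat.exists_eq_succ_of_ne_zero h0.ne'
    exact hinner i hi ▸ List.getElem_mem _
  refine ⟨L.length, P, ⟨rfl, ?_, fun i hi => (hstep i hi).lt, fun i hi => (hstep i hi).dist,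
    fun i h0 hi => hmem _ (hmemL i h0 hi), fun v => ?_,
    fun i h0 hi v t heq => hunique v t (heq ▸ hmemL i h0 hi)⟩,
    fun i hi => (hstep i hi).not_forbidden⟩
  · simp [hP, hW]
  · obtain ⟨i, hi, heq⟩ := List.getElem_of_mem (hvisit v)
    exact ⟨i + 1, i.succ_pos, hi, (hinner i hi).trans heq⟩

/-! ## Guesses that meet prescribed targets -/

theorem grow_iterate_mono (i : ℕ) : Monotone grow^[i] :=
  Monotone.iterate (fun a b h => by unfold grow; lia) i

/-- The scales of the guess with the least thresholds that are at least `32 D 1, 32 D 2, …`. -/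
noncomputable def targetScale (D : ℕ → ℕ) : ℕ → ℕ
  | 0 => 32
  | j + 1 =>
    grow^[skipsTo (targetScale D j) (D (j + 1))] (targetScale D j) +
      grow^[skipsTo (targetScale D j) (D (j + 1))] (targetScale D j) / 2

/-- The number of increases of the scale in stage `j + 1` of that guess. -/
noncomputable def targetSkips (D : ℕ → ℕ) (j : ℕ) : ℕ := skipsTo (targetScale D j) (D (j + 1))

/-- The thresholds of that guess. -/
noncomputable def targetThreshold (D : ℕ → ℕ) : ℕ → ℕ
  | 0 => 0
  | j + 1 => grow^[targetSkips D j] (targetScale D j)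

theorem targetScale_succ (D : ℕ → ℕ) (j : ℕ) :
    targetScale D (j + 1) = targetThreshold D (j + 1) + targetThreshold D (j + 1) / 2 :=
  rfl

theorem le_targetScale (D : ℕ → ℕ) (j : ℕ) : 32 ≤ targetScale D j := by
  induction j with
  | zero => rfl
  | succ j ih => exact (ih.trans (le_grow_iterate _ _)).trans (Nat.le_add_right _ _)

theorem le_targetThreshold (D : ℕ → ℕ) (j : ℕ) : 32 * D (j + 1) ≤ targetThreshold D (j + 1) := by
  have h : D (j + 1) ≤ targetThreshold D (j + 1) / 32 := le_of_skipsTo (le_targetScale D j) _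
  lia

theorem targetThreshold_le {D : ℕ → ℕ} {j : ℕ} (hpos : 0 < D (j + 1)) :
    2 * targetThreshold D (j + 1) ≤ 3 * targetThreshold D j + 66 * D (j + 1) := by
  rcases h : targetSkips D j with _ | m
  · have hle : targetThreshold D (j + 1) = targetScale D j := by
      rw [targetThreshold, h, Function.iterate_zero, id]
    cases j with
    | zero => rw [hle, targetScale]; lia
    | succ j => rw [hle, targetScale_succ]; lia
  · have hlt : grow^[m] (targetScale D j) / 32 < D (j + 1) :=
      lt_of_lt_skipsTo (m.lt_succ_self.trans_eq h.symm)
    rw [targetThreshold, h, Function.iterate_succ_apply', grow]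
    lia

theorem grow_iterate_sum_le (D : ℕ → ℕ) (j : ℕ) :
    grow^[∑ i ∈ Finset.range j, targetSkips D i] 32 ≤ targetScale D j := by
  induction j with
  | zero => rfl
  | succ j ih =>
    rw [Finset.sum_range_succ, add_comm, Function.iterate_add_apply]
    exact (grow_iterate_mono _ ih).trans (Nat.le_add_right _ _)

theorem sum_targetSkips_le {D : ℕ → ℕ} {B k : ℕ} (hD : ∀ j < k, D (j + 1) ≤ B) :
    ∑ i ∈ Finset.range k, targetSkips D i ≤ skipsTo 32 B := by
  induction k with
  | zero => simp
  | succ k ih =>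
    have ih := ih fun j hj => hD j (by lia)
    rw [Finset.sum_range_succ]
    rcases h : targetSkips D k with _ | m
    · exact ih
    set S := ∑ i ∈ Finset.range k, targetSkips D i
    have hlt : grow^[m] (targetScale D k) / 32 < D (k + 1) :=
      lt_of_lt_skipsTo (m.lt_succ_self.trans_eq h.symm)
    have hle : grow^[S + m] 32 ≤ grow^[m] (targetScale D k) := by
      rw [add_comm, Function.iterate_add_apply]
      exact grow_iterate_mono _ (grow_iterate_sum_le D k)
    by_contra! hcon
    have hmono : grow^[skipsTo 32 B] 32 ≤ grow^[S + m] 32 :=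
      Function.monotone_iterate_of_id_le le_grow (by lia) 32
    have hB := le_of_skipsTo le_rfl B
    have hDB := hD k k.lt_succ_self
    lia

theorem exists_guess_of_targets {k : ℕ} (I : Instance n) {D : ℕ → ℕ}
    (hD : ∀ j < k, D (j + 1) ≤ I.reach k) (b : ℕ → Prop) :
    ∃ g < I.guessCount k, (∀ j ≤ k, threshold g j = targetThreshold D j) ∧
      ∀ j < k, (0 < tourBit g j ↔ b j) := by
  obtain ⟨g, hg, h⟩ := exists_guess k (targetSkips D) b
  have hscale : ∀ j ≤ k, scale g j = targetScale D j := by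
    intro j hj
    induction j with
    | zero => rfl
    | succ j ih => rw [scale, ih (by lia), (h j hj).1]; rfl
  refine ⟨g, hg.trans_le ?_, fun j hj => ?_, fun j hj => (h j hj).2⟩
  · exact Nat.mul_le_mul_right _ (Nat.pow_le_pow_right two_pos (sum_targetSkips_le hD))
  · cases j with
    | zero => rfl
    | succ j => rw [threshold, targetThreshold, hscale j (by lia), (h j hj).1]

/-! ## Stages -/

/-- The number of clients in the first `j` of `k` blocks, which have sizes `2 ^ (k - 1), …, 1`. -/
def blockEnd (k j : ℕ) : ℕ := 2 ^ k - 2 ^ (k - j)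

theorem blockEnd_zero (k : ℕ) : blockEnd k 0 = 0 := Nat.sub_self _

theorem blockEnd_add {k j : ℕ} (hj : j ≤ k) : blockEnd k j + 2 ^ (k - j) = 2 ^ k :=
  Nat.sub_add_cancel (Nat.pow_le_pow_right two_pos (by lia))

theorem blockEnd_succ {k j : ℕ} (hj : j < k) :
    blockEnd k (j + 1) = blockEnd k j + 2 ^ (k - (j + 1)) := by
  have hpow : 2 ^ (k - j) = 2 ^ (k - (j + 1)) * 2 := by rw [← pow_succ]; congr 1; lia
  have h := blockEnd_add hj.le
  have h' := blockEnd_add (Nat.succ_le_of_lt hj)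
  lia

theorem blockEnd_mono (k : ℕ) : Monotone (blockEnd k) := fun _ _ h =>
  Nat.sub_le_sub_left (Nat.pow_le_pow_right two_pos (by lia)) _

theorem blockEnd_lt {k j : ℕ} (hj : j < k) : blockEnd k j < blockEnd k (j + 1) := by
  rw [blockEnd_succ hj]
  exact Nat.lt_add_of_pos_right (by positivity)

/-- With stages that end at the points `p 1, p 2, …`, the point `m` is bad for stage `j` if an edge
from a point of an earlier stage `i + 1 ≤ j - 2` without a tour to `m` is not `t (i + 2)`-short. -/
def IsBad (c : ℕ → ℕ → ℕ) (t p : ℕ → ℕ) (tour : ℕ → Prop) (j m : ℕ) : Prop :=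
  ∃ i, i + 3 ≤ j ∧ ¬ tour (i + 1) ∧
    ∃ l, p i < l ∧ l ≤ p (i + 1) ∧ max (c m l) (t (i + 2)) < c l m

/-- Stage `j + 1` consists of the points `p j + 1, …, p (j + 1)`. It has a tour if there is a bad
point among the points of the first `j + 1` blocks that are left, and then it ends at the last bad
one; otherwise it takes all these points. -/
structure IsStaging (c : ℕ → ℕ → ℕ) (t : ℕ → ℕ) (k : ℕ) (p : ℕ → ℕ) (tour : ℕ → Prop) :
    Prop where
  zero : p 0 = 0
  not_tour_zero : ¬ tour 0
  of_tour : ∀ j < k, tour (j + 1) → p j < p (j + 1) ∧ p (j + 1) ≤ blockEnd k (j + 1) ∧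
    IsBad c t p tour (j + 1) (p (j + 1))
  of_not_tour : ∀ j < k, ¬ tour (j + 1) → p (j + 1) = blockEnd k (j + 1)
  not_bad : ∀ j < k, ∀ m ≤ blockEnd k (j + 1), p j < m → (tour (j + 1) → p (j + 1) < m) →
    ¬ IsBad c t p tour (j + 1) m

open Classical in
/-- The last number up to `b` with the property `B`, or `b` if there is none, together with the
proposition that there is one. -/
noncomputable def lastUpTo (B : ℕ → Prop) (b : ℕ) : ℕ × Prop :=
  if ∃ m ≤ b, B m then (Nat.findGreatest B b, True) else (b, False)

theorem lastUpTo_spec (B : ℕ → Prop) (b : ℕ) :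
    ((lastUpTo B b).2 → (lastUpTo B b).1 ≤ b ∧ B (lastUpTo B b).1) ∧
      (¬ (lastUpTo B b).2 → (lastUpTo B b).1 = b) ∧
      ∀ m ≤ b, ((lastUpTo B b).2 → (lastUpTo B b).1 < m) → ¬ B m := by
  classical
  rw [lastUpTo]
  split_ifs with h
  · obtain ⟨m, hm, hBm⟩ := h
    exact ⟨fun _ => ⟨Nat.findGreatest_le b, Nat.findGreatest_spec hm hBm⟩,
      fun h => (h trivial).elim,
      fun m hm hlast => Nat.findGreatest_is_greatest (hlast trivial) hm⟩
  · exact ⟨False.elim, fun _ => rfl, fun m hm _ hBm => h ⟨m, hm, hBm⟩⟩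

/-- The end of stage `j`, and whether it has a tour. The definition of `IsBad` is repeated to show
that the recursion ends. -/
noncomputable def stage (c : ℕ → ℕ → ℕ) (t : ℕ → ℕ) (k : ℕ) : ℕ → ℕ × Prop
  | 0 => (0, False)
  | j + 1 =>
    lastUpTo (fun m => (stage c t k j).1 < m ∧
      ∃ i, ∃ _ : i + 3 ≤ j + 1, ¬ (stage c t k (i + 1)).2 ∧
        ∃ l, (stage c t k i).1 < l ∧ l ≤ (stage c t k (i + 1)).1 ∧
          max (c m l) (t (i + 2)) < c l m) (blockEnd k (j + 1))

theorem stage_succ (c : ℕ → ℕ → ℕ) (t : ℕ → ℕ) (k j : ℕ) :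
    stage c t k (j + 1) = lastUpTo (fun m => (stage c t k j).1 < m ∧
      IsBad c t (fun i => (stage c t k i).1) (fun i => (stage c t k i).2) (j + 1) m)
      (blockEnd k (j + 1)) := by
  rw [stage]
  simp only [IsBad, exists_prop]

theorem isStaging_stage (c : ℕ → ℕ → ℕ) (t : ℕ → ℕ) (k : ℕ) :
    IsStaging c t k (fun j => (stage c t k j).1) (fun j => (stage c t k j).2) where
  zero := by rw [stage]
  not_tour_zero := by rw [stage]; exact id
  of_tour j _ ht := by
    rw [stage_succ] at ht ⊢
    obtain ⟨hle, hlt, hbad⟩ := (lastUpTo_spec _ _).1 ht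
    exact ⟨hlt, hle, hbad⟩
  of_not_tour j _ ht := by
    rw [stage_succ] at ht ⊢
    exact (lastUpTo_spec _ _).2.1 ht
  not_bad j _ m hm hlt hlast hbad := by
    rw [stage_succ] at hlast
    exact (lastUpTo_spec _ _).2.2 m hm hlast ⟨hlt, hbad⟩

/-! ## Distances along a path -/

theorem waypoint_client (π : Equiv.Perm (Fin n)) {m : ℕ} (h0 : 0 < m) (hm : m ≤ n) :
    waypoint π m = .client (π ⟨m - 1, by lia⟩) := by
  obtain ⟨m, rfl⟩ := Nat.exists_eq_succ_of_ne_zero h0.ne'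
  exact dif_pos hm

theorem locOf_client (v : Fin n) : locOf n v = .client v := dif_pos v.2

theorem sub_le_count (π : Equiv.Perm (Fin n)) {Q : Loc n → Prop} [DecidablePred Q] {a b : ℕ}
    (hb : b ≤ n) (hQ : ∀ m, a < m → m ≤ b → Q (waypoint π m)) :
    b - a ≤ Nat.count (fun w => Q (locOf n w)) n := by
  let s : Finset (Fin n) :=
    (Finset.Ico a b).attachFin fun m hm => (Finset.mem_Ico.1 hm).2.trans_le hb
  have hs : (s.map (π.toEmbedding.trans Fin.valEmbedding)).card = b - a := by
    rw [Finset.card_map, Finset.card_attachFin, Nat.card_Ico]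
  rw [← hs, Nat.count_eq_card_filter_range]
  refine Finset.card_le_card fun w hw => ?_
  obtain ⟨j, hj, rfl⟩ := Finset.mem_map.1 hw
  obtain ⟨haj, hjb⟩ := Finset.mem_Ico.1 ((Finset.mem_attachFin _).1 hj)
  have hQj := hQ (j + 1) (by lia) hjb
  rw [waypoint_client π j.1.succ_pos j.2] at hQj
  refine Finset.mem_filter.2 ⟨Finset.mem_range.2 (π j).2, ?_⟩
  change Q (locOf n (π j))
  rwa [locOf_client]

theorem exists_of_lt_count (π : Equiv.Perm (Fin n)) {Q : Loc n → Prop} [DecidablePred Q] {a b : ℕ}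
    (hb : b ≤ n) (hQ : n < Nat.count (fun w => Q (locOf n w)) n + (b - a)) :
    ∃ m, a < m ∧ m ≤ b ∧ Q (waypoint π m) := by
  by_contra! hcon
  have hnot := sub_le_count π (Q := fun x => ¬ Q x) hb hcon
  have hsplit := Finset.card_filter_add_card_filter_not (s := Finset.range n)
    fun w => Q (locOf n w)
  simp only [Nat.count_eq_card_filter_range, Finset.card_range] at hnot hQ hsplit
  lia

namespace Instance

variable (I : Instance n) (π : Equiv.Perm (Fin n))

/-- The distance between two points of a path, given by their numbers. -/
def pathDist (l m : ℕ) : ℕ := I.c (waypoint π l) (waypoint π m)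

theorem pathDist_triangle (l m o : ℕ) :
    I.pathDist π l o ≤ I.pathDist π l m + I.pathDist π m o :=
  I.triangle _ _ _

theorem arrival_succ (m : ℕ) : I.arrival π (m + 1) = I.arrival π m + I.pathDist π m (m + 1) :=
  Finset.sum_range_succ _ _

theorem pathDist_add_arrival_le {l m : ℕ} (h : l ≤ m) :
    I.pathDist π l m + I.arrival π l ≤ I.arrival π m := by
  induction m, h using Nat.le_induction with
  | base => rw [pathDist, I.c_self, zero_add]
  | succ m _ ih =>
    have hsucc := I.arrival_succ π m
    have htri := I.pathDist_triangle π l m (m + 1)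
    lia

theorem arrival_mono : Monotone (I.arrival π) := fun _ _ h =>
  (Nat.le_add_left _ _).trans (I.pathDist_add_arrival_le π h)

end Instance

/-! ## Tours and their roots -/

/-- Stages of a path for thresholds that are large enough for its blocks. -/
structure IsStaged (I : Instance n) (π : Equiv.Perm (Fin n)) (k : ℕ) (t p : ℕ → ℕ)
    (tour : ℕ → Prop) : Prop where
  card : n + 1 = 2 ^ k
  t_zero : t 0 = 0
  t_gap : ∀ j, 3 * t j ≤ 2 * t (j + 1) + 1
  arrival_le_succ : ∀ j < k, 32 * I.arrival π (blockEnd k (j + 1)) ≤ t (j + 1)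
  staging : IsStaging (I.pathDist π) t k p tour

namespace IsStaged

variable {I : Instance n} {π : Equiv.Perm (Fin n)} {k : ℕ} {t p : ℕ → ℕ} {tour : ℕ → Prop}
  {i j m : ℕ}

theorem blockEnd_le (h : IsStaged I π k t p tour) (j : ℕ) : blockEnd k j ≤ n := by
  have hcard := h.card
  have hpos := Nat.two_pow_pos (k - j)
  unfold blockEnd
  lia

theorem t_mono (h : IsStaged I π k t p tour) : Monotone t :=
  monotone_nat_of_le_succ fun j => by
    have := h.t_gap j
    lia

theorem scale_mono (h : IsStaged I π k t p tour) (hij : i ≤ j) : t i / 32 ≤ t j / 32 :=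
  Nat.div_le_div_right (h.t_mono hij)

theorem arrival_le (h : IsStaged I π k t p tour) (hj : j ≤ k) (hm : m ≤ blockEnd k j) :
    I.arrival π m ≤ t j / 32 := by
  refine (I.arrival_mono π hm).trans ?_
  cases j with
  | zero => simp [blockEnd_zero, Instance.arrival]
  | succ j =>
    have := h.arrival_le_succ j hj
    lia

theorem eq_of_not_tour (h : IsStaged I π k t p tour) (hj : j ≤ k) (ht : ¬ tour j) :
    p j = blockEnd k j := by
  cases j with
  | zero => rw [h.staging.zero, blockEnd_zero]
  | succ j => exact h.staging.of_not_tour j hj ht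

theorem p_le (h : IsStaged I π k t p tour) (hj : j ≤ k) : p j ≤ blockEnd k j := by
  cases j with
  | zero => rw [h.staging.zero]; exact Nat.zero_le _
  | succ j =>
    by_cases ht : tour (j + 1)
    · exact (h.staging.of_tour j hj ht).2.1
    · exact (h.staging.of_not_tour j hj ht).le

theorem p_lt (h : IsStaged I π k t p tour) (hj : j < k) : p j < p (j + 1) := by
  by_cases ht : tour (j + 1)
  · exact (h.staging.of_tour j hj ht).1
  · rw [h.staging.of_not_tour j hj ht]
    exact (h.p_le hj.le).trans_lt (blockEnd_lt hj)

theorem p_mono (h : IsStaged I π k t p tour) (hij : i ≤ j) (hj : j ≤ k) : p i ≤ p j := by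
  induction j, hij using Nat.le_induction with
  | base => rfl
  | succ j _ ih => exact (ih (by lia)).trans (h.p_lt hj).le

/-- If the tour stage `j + 1` ended in block `j`, then its last point, which is bad, would be bad
for the tour stage `j` already, or closer to the origin than a threshold. -/
theorem blockEnd_lt_p (h : IsStaged I π k t p tour) (hj : j < k) :
    blockEnd k j < p (j + 1) := by
  by_cases ht : tour (j + 1)
  swap
  · rw [h.staging.of_not_tour j hj ht]
    exact blockEnd_lt hj
  obtain ⟨hlt, -, i, hi, hti, l, hl, hl', hbad⟩ := h.staging.of_tour j hj ht
  by_cases ht' : tour j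
  swap
  · rwa [h.eq_of_not_tour hj.le ht'] at hlt
  by_contra! hle
  rcases j with _ | j
  · exact h.staging.not_tour_zero ht'
  by_cases hij : i + 3 ≤ j + 1
  · exact h.staging.not_bad j (by lia) _ hle ((h.p_lt (by lia)).trans hlt) (fun _ => hlt)
      ⟨i, hij, hti, l, hl, hl', hbad⟩
  · obtain rfl : j = i + 1 := by lia
    have hstage := h.p_lt (j := i + 1) (by lia)
    have hdist := I.pathDist_add_arrival_le π (l := l) (m := p (i + 1 + 1 + 1)) (by lia)
    have harr := h.arrival_le hj.le hle
    have hlong : t (i + 1 + 1) < _ := (le_max_right _ _).trans_lt hbad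
    lia

theorem p_last (h : IsStaged I π k t p tour) : p k = n := by
  have hle := (h.p_le le_rfl).trans (h.blockEnd_le k)
  have hcard := h.card
  rcases k with _ | k
  · lia
  · have hlt := h.blockEnd_lt_p k.lt_succ_self
    have hadd := blockEnd_add k.le_succ
    rw [Nat.succ_eq_add_one, Nat.add_sub_cancel_left, pow_one] at hadd
    lia

theorem arrival_p_le (h : IsStaged I π k t p tour) (hj : j ≤ k) : I.arrival π (p j) ≤ t j / 32 :=
  h.arrival_le hj (h.p_le hj)

/-- Since the last point of a stage with a tour is bad, some early point can be reached from it
cheaply. -/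
theorem exists_return (h : IsStaged I π k t p tour) (hj : j < k) (ht : tour (j + 1)) :
    ∃ i l, i + 2 ≤ j ∧ ¬ tour (i + 1) ∧ l ≤ p (i + 1) ∧
      I.pathDist π (p (j + 1)) l + I.arrival π l ≤ I.arrival π (p (j + 1)) := by
  obtain ⟨hlt, -, i, hi, hti, l, -, hl, hbad⟩ := h.staging.of_tour j hj ht
  refine ⟨i, l, by lia, hti, hl, ?_⟩
  have hmono := h.p_mono (i := i + 1) (j := j) (by lia) hj.le
  have hdist := I.pathDist_add_arrival_le π (l := l) (m := p (j + 1)) (by lia)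
  have hback := (le_max_left _ _).trans_lt hbad
  lia

theorem two_le_of_tour (h : IsStaged I π k t p tour) (hj : j < k) (ht : tour (j + 1)) :
    2 ≤ j := by
  obtain ⟨i, u, hi, -⟩ := h.exists_return hj ht
  lia

/-- In a stage with a tour, one can go back within the preceding block: along the path to the end
of the stage, then to an early point, and from there along the path again. -/
theorem pathDist_back_le (h : IsStaged I π k t p tour) (hj : j < k) (ht : tour (j + 1))
    {w l : ℕ} (hw : blockEnd k (j - 1) < w) (hwl : w ≤ l) (hl : l ≤ blockEnd k j) :
    I.pathDist π l w ≤ 2 * (t (j + 1) / 32) := by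
  obtain ⟨i, u, hi, -, hu, hret⟩ := h.exists_return hj ht
  have huw : u ≤ w := by
    have := h.p_le (j := i + 1) (by lia)
    have := blockEnd_mono k (show i + 1 ≤ j - 1 by lia)
    lia
  have hforth := I.pathDist_add_arrival_le π (hl.trans (h.blockEnd_lt_p hj).le)
  have hback := I.pathDist_add_arrival_le π huw
  have htri := I.pathDist_triangle π l (p (j + 1)) w
  have htri' := I.pathDist_triangle π (p (j + 1)) u w
  have harr := h.arrival_p_le (j := j + 1) hj
  have hmono := I.arrival_mono π hwl
  lia

theorem blockEnd_eq_of_tour (h : IsStaged I π k t p tour) (hj : j < k) (ht : tour (j + 1)) :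
    blockEnd k j = blockEnd k (j - 1) + 2 ^ (k - j) ∧ blockEnd k j + 2 ^ (k - j) = n + 1 := by
  have hsucc := blockEnd_succ (k := k) (j := j - 1) (by lia)
  rw [Nat.sub_add_cancel (one_le_two.trans (h.two_le_of_tour hj ht))] at hsucc
  exact ⟨hsucc, by rw [h.card, blockEnd_add hj.le]⟩

/-- The last client of the block before a stage with a tour is central. -/
theorem exists_isCentral (h : IsStaged I π k t p tour) (hj : j < k) (ht : tour (j + 1)) :
    ∃ r < n, IsCentral I.cost n (t (j + 1) / 32) (2 ^ (k - j)) r := by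
  obtain ⟨hpred, hcompl⟩ := h.blockEnd_eq_of_tour hj ht
  have hle := h.blockEnd_le j
  have hlast := waypoint_client π (m := blockEnd k j) (hpred ▸ by positivity) hle
  set v := π ⟨blockEnd k j - 1, _⟩
  rw [← locOf_client v] at hlast
  refine ⟨v, v.2, ?_, ?_⟩
  · have hball : blockEnd k j - 0 ≤ ballIn I.cost n (t (j + 1) / 32) v := by
      refine sub_le_count π (Q := fun x => I.c x (locOf n v) ≤ _) hle fun m _ hm => ?_
      rw [← hlast]
      exact (Nat.le_of_add_right_le (I.pathDist_add_arrival_le π hm)).trans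
        ((h.arrival_le hj.le le_rfl).trans (h.scale_mono j.le_succ))
    lia
  · have hball : blockEnd k j - blockEnd k (j - 1) ≤ ballOut I.cost n (2 * (t (j + 1) / 32)) v := by
      refine sub_le_count π (Q := fun x => I.c (locOf n v) x ≤ _) hle fun m hm hm' => ?_
      rw [← hlast]
      exact h.pathDist_back_le hj ht hm hm' le_rfl
    lia

end IsStaged

/-- Stages together with words for their tours, as in `Triple.encode`, and with roots: `r j` is the
root for stage `j + 1` if this has a tour. -/
structure IsPlan (I : Instance n) (π : Equiv.Perm (Fin n)) (k : ℕ) (t p w : ℕ → ℕ)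
    (r : ℕ → Fin n) : Prop extends IsStaged I π k t p (0 < w ·) where
  word_eq : ∀ j < k, 0 < w (j + 1) → w (j + 1) = r j + 1
  root_eq : ∀ j < k, 0 < w (j + 1) → 0 < w j → r j = r (j - 1)
  central : ∀ j < k, 0 < w (j + 1) → ¬ 0 < w j →
    IsCentral I.cost n (t (j + 1) / 32) (2 ^ (k - j)) (r j)

namespace IsPlan

variable {I : Instance n} {π : Equiv.Perm (Fin n)} {k : ℕ} {t p w : ℕ → ℕ} {r : ℕ → Fin n} {j : ℕ}

/-- All but fewer than `2 ^ (k - j)` clients are close to a central client, and as many as that are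
close from it, hence some client of block `j`, which has this size, is close to it, and some client
of the first `j` blocks is close from it. -/
theorem exists_close_of_central (h : IsPlan I π k t p w r) (hj : j < k) (ht : 0 < w (j + 1))
    (ht' : ¬ 0 < w j) :
    (∃ m, blockEnd k (j - 1) < m ∧ m ≤ blockEnd k j ∧
      I.c (waypoint π m) (.client (r j)) ≤ t (j + 1) / 32) ∧
    ∃ m ≤ blockEnd k j, I.c (.client (r j)) (waypoint π m) ≤ 2 * (t (j + 1) / 32) := by
  obtain ⟨hpred, hcompl⟩ := h.blockEnd_eq_of_tour hj ht
  obtain ⟨hin, hout⟩ := h.central j hj ht ht'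
  rw [← locOf_client]
  constructor
  · refine exists_of_lt_count π (Q := fun x => I.c x (locOf n (r j)) ≤ _) (h.blockEnd_le j) ?_
    change n < ballIn I.cost n _ _ + _
    lia
  · obtain ⟨m, -, hm⟩ := exists_of_lt_count π (a := 0) (h.blockEnd_le j)
      (Q := fun x => I.c (locOf n (r j)) x ≤ 2 * (t (j + 1) / 32))
      (by change n < ballOut I.cost n _ _ + _; lia)
    exact ⟨m, hm⟩

/-- The root of a tour is chosen in the first stage of a sequence of consecutive tours. -/
theorem exists_first (h : IsPlan I π k t p w r) (hj : j < k) (ht : 0 < w (j + 1)) :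
    ∃ i ≤ j, (∀ l, i ≤ l → l ≤ j → 0 < w (l + 1)) ∧ ¬ 0 < w i ∧ r j = r i := by
  induction j with
  | zero => exact absurd (h.two_le_of_tour hj ht) (by lia)
  | succ j ih =>
    by_cases ht' : 0 < w (j + 1)
    · obtain ⟨i, hi, htours, hnot, hroot⟩ := ih (by lia) ht'
      refine ⟨i, by lia, fun l hil hlj => ?_, hnot, (h.root_eq (j + 1) hj ht ht').trans hroot⟩
      rcases Nat.le_succ_iff.1 hlj with hlj | rfl
      exacts [htours l hil hlj, ht]
    · refine ⟨j + 1, le_rfl, fun l hl hl' => ?_, ht', rfl⟩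
      rwa [le_antisymm hl' hl]

theorem dist_last_root_le (h : IsPlan I π k t p w r) (hj : j < k) (ht : 0 < w (j + 1)) :
    I.c (waypoint π (p (j + 1))) (.client (r j)) ≤ 4 * (t (j + 1) / 32) := by
  obtain ⟨i, hi, htours, hnot, hroot⟩ := h.exists_first hj ht
  obtain ⟨⟨m, hm, hm', hmr⟩, -⟩ :=
    h.exists_close_of_central (hi.trans_lt hj) (htours i le_rfl hi) hnot
  obtain ⟨e, u, he, hte, hu, hret⟩ := h.exists_return hj ht
  have hei : e + 1 ≤ i := by
    by_contra! hcon
    exact hte (htours e (by lia) (by lia))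
  have hu' : u ≤ blockEnd k i := hu.trans ((h.p_le (by lia)).trans (blockEnd_mono k hei))
  have hum : I.pathDist π u m ≤ 2 * (t (i + 1) / 32) := by
    rcases le_total u m with hle | hle
    · have hdist := I.pathDist_add_arrival_le π hle
      have harr := h.arrival_le (by lia) hm'
      have hscale := h.scale_mono i.le_succ
      lia
    · exact h.pathDist_back_le (by lia) (htours i le_rfl hi) hm hle hu'
  have harr := h.arrival_p_le (j := j + 1) hj
  have hscale := h.scale_mono (show i + 1 ≤ j + 1 by lia)
  have htri := I.triangle (waypoint π (p (j + 1))) (waypoint π u) (.client (r j))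
  have htri' := I.triangle (waypoint π u) (waypoint π m) (.client (r j))
  unfold Instance.pathDist at hum hret
  rw [hroot] at htri htri' ⊢
  lia

theorem dist_root_le (h : IsPlan I π k t p w r) (hj : j < k) (ht : 0 < w (j + 1)) {m : ℕ}
    (hm : p j ≤ m) :
    I.c (.client (r j)) (waypoint π m) ≤ 2 * (t (j + 1) / 32) + I.arrival π m := by
  obtain ⟨i, hi, htours, hnot, hroot⟩ := h.exists_first hj ht
  obtain ⟨-, l, hl, hrl⟩ := h.exists_close_of_central (hi.trans_lt hj) (htours i le_rfl hi) hnot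
  have hlm : l ≤ m := by
    have := h.p_mono hi hj.le
    rw [h.eq_of_not_tour (by lia) hnot] at this
    lia
  have hdist := I.pathDist_add_arrival_le π hlm
  have hscale := h.scale_mono (show i + 1 ≤ j + 1 by lia)
  have htri := I.triangle (.client (r j)) (waypoint π l) (waypoint π m)
  unfold Instance.pathDist at hdist
  rw [hroot] at htri ⊢
  lia

theorem dist_enter_le (h : IsPlan I π k t p w r) (hj : j < k) (ht : 0 < w (j + 1))
    (ht' : ¬ 0 < w j) : I.c (waypoint π (p j)) (.client (r j)) ≤ 3 * (t (j + 1) / 32) := by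
  obtain ⟨⟨m, hm, hm', hmr⟩, -⟩ := h.exists_close_of_central hj ht ht'
  rw [h.eq_of_not_tour hj.le ht']
  have hback := h.pathDist_back_le hj ht hm hm' le_rfl
  have htri := I.triangle (waypoint π (blockEnd k j)) (waypoint π m) (.client (r j))
  unfold Instance.pathDist at hback
  lia

end IsPlan

/-! ## The walk of a plan -/

/-- A point as a site: a client stands for itself and not for its copy. -/
def Site.ofLoc : Loc n → Site n
  | .client v => .client v
  | .source => .source
  | .target => .target

theorem Site.loc_ofLoc (u : Loc n) : (ofLoc u).loc = u := by
  cases u <;> rfl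

theorem Site.loc_root (v : Fin n) : (root v).loc = .client v := rfl

theorem Site.loc_target : (target : Site n).loc = .target := rfl

theorem waypoint_ne_succ (π : Equiv.Perm (Fin n)) {m : ℕ} (hm : m < n) :
    waypoint π m ≠ waypoint π (m + 1) := by
  rw [waypoint_client π m.succ_pos hm]
  rcases m.eq_zero_or_pos with rfl | h0
  · exact nofun
  · rw [waypoint_client π h0 hm.le]
    intro heq
    have := congrArg Fin.val (π.injective (Loc.client.inj heq))
    lia

theorem Instance.arrival_lt (I : Instance n) (π : Equiv.Perm (Fin n))
    (hpos : ∀ u v, u ≠ v → 0 < I.c u v) {m : ℕ} (hm : m < n) :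
    I.arrival π m < I.arrival π (m + 1) := by
  rw [I.arrival_succ]
  exact Nat.lt_add_of_pos_right (hpos _ _ (waypoint_ne_succ π hm))

section Items

variable (I : Instance n) (π : Equiv.Perm (Fin n)) (t p w : ℕ → ℕ) (r : ℕ → Fin n)

/-- The time of the visit to point `m` of the path if this is in stage `j`. -/
def clientTime (j m : ℕ) : ℕ := t (j - 1) + 5 * (t j / 32) + I.arrival π m

/-- The visits to clients in stage `j`. -/
def clientItems (j : ℕ) : List (Site n × ℕ) :=
  (List.range' (p (j - 1) + 1) (p j - p (j - 1))).map fun m =>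
    (.ofLoc (waypoint π m), clientTime I π t j m)

/-- The part of the walk in stage `j`: a tour begins and ends at its root. -/
def stageItems (j : ℕ) : List (Site n × ℕ) :=
  if 0 < w j then
    (.root (r (j - 1)), t (j - 1) + 3 * (t j / 32)) ::
      (clientItems I π t p j ++ [(.root (r (j - 1)), t (j - 1) + 10 * (t j / 32))])
  else clientItems I π t p j

/-- The last vertex of the walk in stage `j`; for `j = 0` this is the source. -/
def lastItem (j : ℕ) : Site n × ℕ :=
  if 0 < w j then (.root (r (j - 1)), t (j - 1) + 10 * (t j / 32))
  else (.ofLoc (waypoint π (p j)), clientTime I π t j (p j))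

variable {I π t p} in
theorem mem_clientItems {j : ℕ} (x : Site n × ℕ) : x ∈ clientItems I π t p (j + 1) ↔
    ∃ m, (p j < m ∧ m ≤ p (j + 1)) ∧ x = (.ofLoc (waypoint π m), clientTime I π t (j + 1) m) := by
  rw [clientItems, List.mem_map, Nat.add_sub_cancel]
  refine exists_congr fun m => and_congr ?_ eq_comm
  rw [List.mem_range'_1]
  lia

variable {I π t p w r} in
theorem mem_stageItems {j : ℕ} (x : Site n × ℕ) : x ∈ stageItems I π t p w r (j + 1) ↔
    (0 < w (j + 1) ∧ (x = (.root (r j), t j + 3 * (t (j + 1) / 32)) ∨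
      x = (.root (r j), t j + 10 * (t (j + 1) / 32)))) ∨
    x ∈ clientItems I π t p (j + 1) := by
  rw [stageItems]
  split_ifs with ht
  · simp only [List.mem_cons, List.mem_append, List.not_mem_nil, ht, true_and, or_false,
      Nat.add_sub_cancel]
    tauto
  · simp only [ht, false_and, false_or]

end Items

namespace IsPlan

variable {I : Instance n} {π : Equiv.Perm (Fin n)} {k : ℕ} {t p w : ℕ → ℕ} {r : ℕ → Fin n}
  {hw : ∀ j, w j ≤ n} {j : ℕ} {x y : Site n × ℕ}

theorem gap (h : IsPlan I π k t p w r) (hpos : ∀ u v, u ≠ v → 0 < I.c u v) (hj : j < k) :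
    0 < t (j + 1) / 32 ∧ t j + 10 * (t (j + 1) / 32) < t (j + 1) := by
  have hend := blockEnd_lt hj
  have hle := h.blockEnd_le (j + 1)
  have hfirst := I.arrival_lt π hpos (m := 0) (by lia)
  have hmono := I.arrival_mono π (show 0 + 1 ≤ blockEnd k (j + 1) by lia)
  have harr := h.arrival_le_succ j hj
  have hgap := h.t_gap j
  lia

theorem clientTime_mem (h : IsPlan I π k t p w r) (hj : j < k) {m : ℕ} (hm : m ≤ p (j + 1)) :
    t j + 5 * (t (j + 1) / 32) ≤ clientTime I π t (j + 1) m ∧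
      clientTime I π t (j + 1) m ≤ t j + 6 * (t (j + 1) / 32) := by
  have hend := h.arrival_p_le (j := j + 1) hj
  have harr := I.arrival_mono π hm
  rw [clientTime, Nat.add_sub_cancel]
  lia

theorem lastItem_time (h : IsPlan I π k t p w r) (hpos : ∀ u v, u ≠ v → 0 < I.c u v)
    (hj : j ≤ k) :
    t (j - 1) ≤ (lastItem I π t p w r j).2 ∧ (lastItem I π t p w r j).2 ≤ t j := by
  rcases j with _ | j
  · rw [lastItem, if_neg h.staging.not_tour_zero, h.staging.zero]
    simp only [clientTime, h.t_zero, Instance.arrival, Finset.range_zero, Finset.sum_empty]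
    lia
  · have hgap := h.gap hpos hj
    have htime := h.clientTime_mem hj le_rfl
    rw [lastItem, Nat.add_sub_cancel]
    split_ifs <;> simp only <;> lia

theorem lt_of_t_lt (h : IsPlan I π k t p w r) {i : ℕ} (hij : t i < t j) : i < j :=
  h.t_mono.reflect_lt hij

theorem root_ofWords (h : IsPlan I π k t p w r)
    (i : {i : Fin k // i ∈ (Triple.ofWords k t w hw).tour}) :
    (Triple.ofWords k t w hw).root i = r i.1 := by
  refine Fin.ext ?_
  have htour := (Finset.mem_filter.1 i.2).2
  exact Nat.sub_eq_of_eq_add (h.word_eq i.1 i.1.2 htour)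

/-- An edge is not forbidden if at each threshold that it crosses it leaves from the root of the
tour that ends there, and arrives at the root of the tour that begins there. -/
theorem not_forbidden (h : IsPlan I π k t p w r)
    (hcross : ∀ i ≤ k, x.2 < t i → t i ≤ y.2 → (0 < w i → x.1 = .root (r (i - 1))) ∧
      (i < k → 0 < w (i + 1) → y.1 = .root (r i))) :
    ¬ (Triple.ofWords k t w hw).Forbidden (x, y) := by
  rintro ⟨i, hor⟩
  have htour : 0 < w (i.1 + 1) := (Finset.mem_filter.1 i.2).2
  rw [h.root_ofWords (hw := hw) i] at hor
  rcases hor with ⟨hlt, hle, hne⟩ | ⟨hlt, hle, hne⟩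
  · exact hne ((hcross i.1 i.1.2.le hlt hle).2 i.1.2 htour)
  · exact hne ((hcross (i.1 + 1) i.1.2 hlt hle).1 htour)

theorem isStep_within (h : IsPlan I π k t p w r) (hx : t j ≤ x.2) (hy : y.2 < t (j + 1))
    (hlt : x.2 < y.2) (hdist : x.2 + I.c x.1.loc y.1.loc ≤ y.2) :
    IsStep I (Triple.ofWords k t w hw) x y where
  lt := hlt
  dist := hdist
  not_forbidden := h.not_forbidden fun i _ hxi hiy => by
    have := h.lt_of_t_lt (hx.trans_lt hxi)
    have := h.lt_of_t_lt (hiy.trans_lt hy)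
    lia

theorem isChain_clientItems (h : IsPlan I π k t p w r) (hpos : ∀ u v, u ≠ v → 0 < I.c u v)
    (hj : j < k) :
    (clientItems I π t p (j + 1)).IsChain (IsStep I (Triple.ofWords k t w hw)) := by
  refine (List.isChain_map _).2 ((List.isChain_range' _ _ 1).imp_of_mem_imp ?_)
  rintro m _ hm hm' rfl
  rw [List.mem_range'_1, Nat.add_sub_cancel] at hm hm'
  have hle : m + 1 ≤ p (j + 1) := by lia
  have hn := (h.p_le (j := j + 1) hj).trans (h.blockEnd_le _)
  have hgap := h.gap hpos hj
  have htime := h.clientTime_mem hj (m.le_succ.trans hle)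
  have htime' := h.clientTime_mem hj hle
  refine h.isStep_within (j := j) (by simp only; lia) (by simp only; lia) ?_ ?_
  · exact Nat.add_lt_add_left (I.arrival_lt π hpos (by lia)) _
  · simp only [Site.loc_ofLoc, clientTime, I.arrival_succ, Instance.pathDist, Nat.add_assoc,
      le_refl]

theorem head?_clientItems (h : IsPlan I π k t p w r) (hj : j < k) :
    (clientItems I π t p (j + 1)).head? =
      some (.ofLoc (waypoint π (p j + 1)), clientTime I π t (j + 1) (p j + 1)) := by
  have := h.p_lt hj
  rw [clientItems, List.head?_map, List.head?_range', Nat.add_sub_cancel, if_neg (by lia)]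
  rfl

theorem getLast?_clientItems (h : IsPlan I π k t p w r) (hj : j < k) :
    (clientItems I π t p (j + 1)).getLast? =
      some (.ofLoc (waypoint π (p (j + 1))), clientTime I π t (j + 1) (p (j + 1))) := by
  have := h.p_lt hj
  rw [clientItems, List.getLast?_map, List.getLast?_range', Nat.add_sub_cancel, if_neg (by lia),
    show p j + 1 + (p (j + 1) - p j) - 1 = p (j + 1) by lia]
  rfl

theorem isChain_stageItems (h : IsPlan I π k t p w r) (hpos : ∀ u v, u ≠ v → 0 < I.c u v)
    (hj : j < k) :
    (stageItems I π t p w r (j + 1)).IsChain (IsStep I (Triple.ofWords k t w hw)) := by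
  have hgap := h.gap hpos hj
  have hlt := h.p_lt hj
  rw [stageItems, Nat.add_sub_cancel]
  split_ifs with ht
  swap
  · exact h.isChain_clientItems hpos hj
  rw [List.isChain_cons, List.isChain_append]
  refine ⟨?_, h.isChain_clientItems hpos hj, List.isChain_singleton _, ?_⟩
  · intro y hy
    rw [List.head?_append, h.head?_clientItems hj] at hy
    obtain rfl : _ = y := Option.some.inj hy
    have htime := h.clientTime_mem hj (m := p j + 1) hlt
    have hroot := h.dist_root_le hj ht (p j).le_succ
    refine h.isStep_within (j := j) (Nat.le_add_right _ _) (by simp only; lia)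
      (by simp only; lia) ?_
    simp only [Site.loc_ofLoc, Site.loc_root, clientTime, Nat.add_sub_cancel]
    lia
  · intro x hx y hy
    rw [h.getLast?_clientItems hj] at hx
    obtain rfl : _ = x := Option.some.inj hx
    obtain rfl : _ = y := Option.some.inj hy
    have htime := h.clientTime_mem hj (m := p (j + 1)) le_rfl
    have hroot := h.dist_last_root_le hj ht
    refine h.isStep_within (j := j) (by simp only; lia) hgap.2 (by simp only; lia) ?_
    simp only [Site.loc_ofLoc, Site.loc_root]
    lia

theorem getLast?_stageItems (h : IsPlan I π k t p w r) (hj : j < k) :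
    (stageItems I π t p w r (j + 1)).getLast? = some (lastItem I π t p w r (j + 1)) := by
  rw [stageItems, lastItem]
  split_ifs
  · rw [← List.cons_append, List.getLast?_concat]
  · exact h.getLast?_clientItems hj

theorem head?_stageItems (h : IsPlan I π k t p w r) (hj : j < k) :
    (stageItems I π t p w r (j + 1)).head? =
      some (if 0 < w (j + 1) then (.root (r j), t j + 3 * (t (j + 1) / 32))
        else (.ofLoc (waypoint π (p j + 1)), clientTime I π t (j + 1) (p j + 1))) := by
  rw [stageItems]
  split_ifs
  · rfl
  · exact h.head?_clientItems hj

theorem dist_lastItem_le (h : IsPlan I π k t p w r) (hj : j < k)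
    (hy : (stageItems I π t p w r (j + 1)).head? = some y) :
    t j + I.c (lastItem I π t p w r j).1.loc y.1.loc ≤ y.2 := by
  rw [h.head?_stageItems hj, Option.some.injEq] at hy
  have hscale := h.scale_mono j.le_succ
  rw [lastItem]
  split_ifs at hy with ht <;> split_ifs with ht' <;> subst hy <;>
    simp only [Site.loc_ofLoc, Site.loc_root, clientTime, Nat.add_sub_cancel]
  · rw [h.root_eq j hj ht ht', I.c_self]
    lia
  · have := h.dist_enter_le hj ht ht'
    lia
  · rcases j with _ | j
    · exact absurd ht' h.staging.not_tour_zero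
    have := h.dist_root_le (by lia) ht' (m := p (j + 1) + 1) (by have := h.p_lt (j := j); lia)
    rw [Nat.add_sub_cancel]
    lia
  · have := I.arrival_succ π (p j)
    rw [Instance.pathDist] at this
    lia

theorem isStep_lastItem (h : IsPlan I π k t p w r) (hpos : ∀ u v, u ≠ v → 0 < I.c u v)
    (hj : j < k) (hy : (stageItems I π t p w r (j + 1)).head? = some y) :
    IsStep I (Triple.ofWords k t w hw) (lastItem I π t p w r j) y := by
  have hgap := h.gap hpos hj
  have hlast := h.lastItem_time hpos hj.le
  have hdist := h.dist_lastItem_le hj hy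
  rw [h.head?_stageItems hj, Option.some.injEq] at hy
  have htime : t j < y.2 ∧ y.2 < t (j + 1) := by
    have := h.clientTime_mem hj (m := p j + 1) (h.p_lt hj)
    split_ifs at hy <;> subst hy <;> simp only <;> lia
  refine ⟨hlast.2.trans_lt htime.1, by lia, h.not_forbidden fun i _ hxi hiy => ?_⟩
  have hi := h.lt_of_t_lt (hlast.1.trans_lt hxi)
  have hi' := h.lt_of_t_lt (hiy.trans_lt htime.2)
  obtain rfl : i = j := by lia
  refine ⟨fun ht => ?_, fun _ ht => ?_⟩
  · rw [lastItem, if_pos ht]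
  · rw [← hy, if_pos ht]

theorem isStep_target (h : IsPlan I π k t p w r) (hpos : ∀ u v, u ≠ v → 0 < I.c u v)
    (hn : 0 < n) :
    IsStep I (Triple.ofWords k t w hw) (lastItem I π t p w r k)
      (.target, I.horizon (Triple.ofWords k t w hw) + 1) := by
  have hlast := h.lastItem_time hpos le_rfl
  have hmax := I.c_le_maxCost (lastItem I π t p w r k).1.loc .target
  have hhorizon : t k + I.maxCost ≤ I.horizon (Triple.ofWords k t w hw) :=
    Nat.add_le_add_left (Nat.le_mul_of_pos_left _ (by positivity)) _
  refine ⟨by simp only; lia, by simp only [Site.loc_target]; lia,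
    h.not_forbidden fun i hi hxi _ => ⟨fun ht => ?_, fun hik => ?_⟩⟩
  · have := h.lt_of_t_lt (hlast.1.trans_lt hxi)
    obtain rfl : i = k := by lia
    rw [lastItem, if_pos ht]
  · have := h.lt_of_t_lt (hlast.1.trans_lt hxi)
    lia

theorem isChain_flatMap_stageItems (h : IsPlan I π k t p w r)
    (hpos : ∀ u v, u ≠ v → 0 < I.c u v) (hj : j ≤ k) :
    let L := (.source, 0) :: (List.range j).flatMap fun i => stageItems I π t p w r (i + 1)
    L.IsChain (IsStep I (Triple.ofWords k t w hw)) ∧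
      L.getLast? = some (lastItem I π t p w r j) := by
  induction j with
  | zero =>
    refine ⟨List.isChain_singleton _, congrArg some ?_⟩
    rw [lastItem, if_neg h.staging.not_tour_zero, h.staging.zero]
    simp only [clientTime, h.t_zero, Instance.arrival, Finset.range_zero, Finset.sum_empty]
    rfl
  | succ j ih =>
    obtain ⟨hchain, hlast⟩ := ih (by lia)
    simp only [List.range_succ, List.flatMap_append, List.flatMap_singleton]
    rw [← List.cons_append, List.isChain_append, List.getLast?_append, hlast,
      h.getLast?_stageItems hj]
    refine ⟨⟨hchain, h.isChain_stageItems hpos hj, fun x hx y hy => ?_⟩, rfl⟩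
    obtain rfl : _ = x := Option.some.inj hx
    exact h.isStep_lastItem hpos hj hy

end IsPlan

/-! ## The solution of a plan -/

/-- The number of a client along the path. -/
def place (π : Equiv.Perm (Fin n)) (v : Fin n) : ℕ := (π.symm v : ℕ) + 1

theorem place_pos (π : Equiv.Perm (Fin n)) (v : Fin n) : 0 < place π v := Nat.succ_pos _

theorem place_le (π : Equiv.Perm (Fin n)) (v : Fin n) : place π v ≤ n := (π.symm v).2

theorem waypoint_place (π : Equiv.Perm (Fin n)) (v : Fin n) :
    waypoint π (place π v) = .client v := by
  rw [waypoint_client π (place_pos π v) (place_le π v)]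
  exact congrArg Loc.client (π.apply_symm_apply v)

theorem eq_place {π : Equiv.Perm (Fin n)} {m : ℕ} {v : Fin n} (h0 : 0 < m) (hm : m ≤ n)
    (h : waypoint π m = .client v) : m = place π v := by
  rw [waypoint_client π h0 hm] at h
  rw [place, ← Loc.client.inj h, π.symm_apply_apply]
  exact (Nat.sub_add_cancel h0).symm

/-- The stage that contains the point `m`. -/
noncomputable def stageOf (p : ℕ → ℕ) (m : ℕ) : ℕ := sInf {j | m ≤ p j}

namespace IsStaged

variable {I : Instance n} {π : Equiv.Perm (Fin n)} {k : ℕ} {t p : ℕ → ℕ} {tour : ℕ → Prop}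
  {i j l m : ℕ}

theorem stageOf_eq (h : IsStaged I π k t p tour) (hj : j < k) (hlt : p j < m)
    (hle : m ≤ p (j + 1)) : stageOf p m = j + 1 := by
  refine le_antisymm (Nat.sInf_le hle) (le_csInf ⟨_, hle⟩ fun i (hi : m ≤ p i) => ?_)
  by_contra! hij
  have := h.p_mono (i := i) (j := j) (by lia) hj.le
  lia

theorem exists_stageOf_eq (h : IsStaged I π k t p tour) (h0 : 0 < m) (hm : m ≤ n) :
    ∃ j < k, stageOf p m = j + 1 ∧ p j < m ∧ m ≤ p (j + 1) := by
  have hk : m ≤ p k := hm.trans_eq h.p_last.symm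
  have hmem : m ≤ p (stageOf p m) := Nat.sInf_mem (s := {j | m ≤ p j}) ⟨k, hk⟩
  have hstage : stageOf p m ≤ k := Nat.sInf_le hk
  cases hj : stageOf p m with
  | zero =>
    rw [hj, h.staging.zero] at hmem
    lia
  | succ j =>
    rw [hj] at hmem hstage
    refine ⟨j, hstage, rfl, not_le.1 ?_, hmem⟩
    exact Nat.notMem_of_lt_sInf (s := {j | m ≤ p j}) (j.lt_succ_self.trans_eq hj.symm)

/-- For consecutive stages the distance is bounded by the second threshold, since the path gets
from one point to the other before; otherwise the later point is not bad. -/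
theorem pathDist_le_max (h : IsStaged I π k t p tour) (hij : i < j) (hj : j < k)
    (hti : ¬ tour (i + 1)) (htj : ¬ tour (j + 1)) (hl : p i < l ∧ l ≤ p (i + 1))
    (hm : p j < m ∧ m ≤ p (j + 1)) :
    I.pathDist π l m ≤ max (I.pathDist π m l) (t (i + 2)) := by
  rcases Nat.lt_or_eq_of_le hij with hlt | rfl
  · have hgood := h.staging.not_bad j hj m (hm.2.trans (h.p_le hj)) hm.1 (absurd · htj)
    exact not_lt.1 fun hbad => hgood ⟨i, by lia, hti, l, hl.1, hl.2, hbad⟩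
  · refine le_max_of_le_right ?_
    have hdist := I.pathDist_add_arrival_le π (hl.2.trans hm.1.le)
    have harr := (I.arrival_mono π hm.2).trans (h.arrival_p_le hj)
    exact (by lia : I.pathDist π l m ≤ t (i + 1 + 1))

end IsStaged

/-- The time of the visit to a client. -/
noncomputable def visitTime (I : Instance n) (π : Equiv.Perm (Fin n)) (t p : ℕ → ℕ) (v : Fin n) :
    ℕ := clientTime I π t (stageOf p (place π v)) (place π v)

namespace IsPlan

variable {I : Instance n} {π : Equiv.Perm (Fin n)} {k : ℕ} {t p w : ℕ → ℕ} {r : ℕ → Fin n}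
  {hw : ∀ j, w j ≤ n} {j : ℕ}

theorem mem_roots (h : IsPlan I π k t p w r) (hj : j < k) (ht : 0 < w (j + 1)) :
    r j ∈ (Triple.ofWords k t w hw).roots := by
  have hmem : (⟨j, hj⟩ : Fin k) ∈ (Triple.ofWords k t w hw).tour :=
    Finset.mem_filter.2 ⟨Finset.mem_univ _, ht⟩
  exact Finset.mem_image.2 ⟨⟨_, hmem⟩, Finset.mem_univ _, h.root_ofWords _⟩

theorem exists_visitTime (h : IsPlan I π k t p w r) (hpos : ∀ u v, u ≠ v → 0 < I.c u v)
    (v : Fin n) : ∃ j < k, stageOf p (place π v) = j + 1 ∧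
      (p j < place π v ∧ place π v ≤ p (j + 1)) ∧
      t j ≤ visitTime I π t p v ∧ visitTime I π t p v < t (j + 1) := by
  obtain ⟨j, hj, heq, hplace⟩ := h.exists_stageOf_eq (place_pos π v) (place_le π v)
  have hgap := h.gap hpos hj
  have htime := h.clientTime_mem hj hplace.2
  refine ⟨j, hj, heq, hplace, ?_⟩
  rw [visitTime, heq]
  lia

theorem exists_visit (h : IsPlan I π k t p w r) (v : Fin n) :
    ∃ j < k, (.client v, visitTime I π t p v) ∈ stageItems I π t p w r (j + 1) := by
  obtain ⟨j, hj, heq, hplace⟩ := h.exists_stageOf_eq (place_pos π v) (place_le π v)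
  refine ⟨j, hj, (mem_stageItems _).2 (.inr ((mem_clientItems _).2 ⟨_, hplace, ?_⟩))⟩
  rw [waypoint_place, visitTime, heq]
  rfl

theorem eq_visitTime (h : IsPlan I π k t p w r) (hj : j < k) {v : Fin n} {s : ℕ}
    (hs : (.client v, s) ∈ stageItems I π t p w r (j + 1)) : s = visitTime I π t p v := by
  rcases (mem_stageItems _).1 hs with ⟨-, heq | heq⟩ | hs
  · cases congrArg Prod.fst heq
  · cases congrArg Prod.fst heq
  obtain ⟨m, hm, heq⟩ := (mem_clientItems _).1 hs
  obtain ⟨hloc, rfl⟩ := Prod.mk.inj heq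
  have hn := (h.p_le (j := j + 1) hj).trans (h.blockEnd_le _)
  have hplace : m = place π v := eq_place (by lia) (hm.2.trans hn) <| by
    rw [← Site.loc_ofLoc (waypoint π m), ← hloc]
    rfl
  rw [visitTime, ← hplace, h.stageOf_eq hj hm.1 hm.2]

theorem mem_stageItems_site (h : IsPlan I π k t p w r) (hj : j < k) {x : Site n × ℕ}
    (hx : x ∈ stageItems I π t p w r (j + 1)) : (∃ v, x.1 = .client v) ∨
      ∃ v ∈ (Triple.ofWords k t w hw).roots, x.1 = .root v := by
  rcases (mem_stageItems x).1 hx with ⟨ht, rfl | rfl⟩ | hx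
  · exact .inr ⟨r j, h.mem_roots hj ht, rfl⟩
  · exact .inr ⟨r j, h.mem_roots hj ht, rfl⟩
  · obtain ⟨m, hm, rfl⟩ := (mem_clientItems x).1 hx
    have hn := (h.p_le (j := j + 1) hj).trans (h.blockEnd_le _)
    exact .inl ⟨_, by rw [waypoint_client π (by lia) (hm.2.trans hn)]; rfl⟩

theorem exists_isWalk (h : IsPlan I π k t p w r) (hpos : ∀ u v, u ≠ v → 0 < I.c u v)
    (hn : 0 < n) (hw : ∀ j, w j ≤ n) :
    ∃ N P, IsWalk I (Triple.ofWords k t w hw).roots (I.horizon (Triple.ofWords k t w hw)) N P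
        (visitTime I π t p) ∧
      ∀ i ≤ N, ¬ (Triple.ofWords k t w hw).Forbidden (P i, P (i + 1)) := by
  obtain ⟨hchain, hlast⟩ := h.isChain_flatMap_stageItems (hw := hw) hpos le_rfl
  have hmem : ∀ x, x ∈ (List.range k).flatMap (fun i => stageItems I π t p w r (i + 1)) ↔
      ∃ j < k, x ∈ stageItems I π t p w r (j + 1) := fun x => by
    simp only [List.mem_flatMap, List.mem_range]
  refine DirLat.exists_isWalk (I := I) (G := Triple.ofWords k t w hw)
    (L := (List.range k).flatMap fun i => stageItems I π t p w r (i + 1)) ?_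
    (fun x hx => ?_) (fun v => (hmem _).2 (h.exists_visit v)) (fun v s hs => ?_)
  · rw [← List.cons_append, List.isChain_append]
    refine ⟨hchain, List.isChain_singleton _, fun x hx y hy => ?_⟩
    rw [hlast] at hx
    obtain rfl : _ = x := Option.some.inj hx
    obtain rfl : _ = y := Option.some.inj hy
    exact h.isStep_target hpos hn
  · obtain ⟨j, hj, hx⟩ := (hmem x).1 hx
    exact h.mem_stageItems_site hj hx
  · obtain ⟨j, hj, hs⟩ := (hmem _).1 hs
    exact h.eq_visitTime hj hs

theorem isShort_of_notMem_tourTimes (h : IsPlan I π k t p w r)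
    (hpos : ∀ u v, u ≠ v → 0 < I.c u v) {u v : Fin n} {e : ℕ}
    (hu : visitTime I π t p u ∉ (Triple.ofWords k t w hw).tourTimes)
    (hv : visitTime I π t p v ∉ (Triple.ofWords k t w hw).tourTimes)
    (hue : visitTime I π t p u < t (e + 1)) (hev : t (e + 1) ≤ visitTime I π t p v) :
    I.IsShort u v (t (e + 2)) := by
  have hnot : ∀ v j, j < k → t j ≤ visitTime I π t p v → visitTime I π t p v < t (j + 1) →
      visitTime I π t p v ∉ (Triple.ofWords k t w hw).tourTimes → ¬ 0 < w (j + 1) :=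
    fun v j hj hle hlt hv ht => hv <| Finset.mem_biUnion.2
      ⟨⟨j, hj⟩, Finset.mem_filter.2 ⟨Finset.mem_univ _, ht⟩, Finset.mem_Ico.2 ⟨hle, hlt⟩⟩
  obtain ⟨i, hi, -, hplaceu, hleu, hltu⟩ := h.exists_visitTime hpos u
  obtain ⟨j, hj, -, hplacev, hlev, hltv⟩ := h.exists_visitTime hpos v
  have hie := h.lt_of_t_lt (hleu.trans_lt hue)
  have hej := h.lt_of_t_lt (hev.trans_lt hltv)
  have hdist := h.pathDist_le_max (by lia) hj (hnot u i hi hleu hltu hu)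
    (hnot v j hj hlev hltv hv) hplaceu hplacev
  rw [Instance.pathDist, Instance.pathDist, waypoint_place, waypoint_place] at hdist
  exact hdist.trans (max_le_max le_rfl (h.t_mono (by lia)))

theorem lpCost_walk (h : IsPlan I π k t p w r) (hpos : ∀ u v, u ≠ v → 0 < I.c u v)
    {N : ℕ} {P : ℕ → Site n × ℕ} (hwalk : IsWalk I (Triple.ofWords k t w hw).roots
      (I.horizon (Triple.ofWords k t w hw)) N P (visitTime I π t p)) :
    I.lpCost (Triple.ofWords k t w hw) (walkVisits N P) =
      ∑ v, (t (stageOf p (place π v)) : ℝ) := by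
  rw [hwalk.lpCost_eq]
  refine Finset.sum_congr rfl fun v _ => ?_
  obtain ⟨j, hj, heq, -, hle, hlt⟩ := h.exists_visitTime hpos v
  rw [heq]
  refine (Fintype.sum_eq_single (⟨j, hj⟩ : Fin k) fun i hij => if_neg fun hi => ?_).trans
    (if_pos (Finset.mem_Ico.2 ⟨hle, hlt⟩))
  obtain ⟨hle', hlt'⟩ : t i ≤ visitTime I π t p v ∧ visitTime I π t p v < t (i + 1) :=
    Finset.mem_Ico.1 hi
  have hji := h.lt_of_t_lt (hle.trans_lt hlt')
  have hij' := h.lt_of_t_lt (hle'.trans_lt hlt)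
  exact hij (Fin.ext (by lia))

theorem exists_isFeasible (h : IsPlan I π k t p w r) (hpos : ∀ u v, u ≠ v → 0 < I.c u v)
    (hn : 0 < n) (hw : ∀ j, w j ≤ n) :
    ∃ x z, I.IsFeasible (Triple.ofWords k t w hw) x z ∧
      I.lpCost (Triple.ofWords k t w hw) x = ∑ v, (t (stageOf p (place π v)) : ℝ) := by
  obtain ⟨N, P, hwalk, hforbidden⟩ := h.exists_isWalk hpos hn hw
  refine ⟨_, _, hwalk.isFeasible hforbidden (fun v => ?_) ?_, h.lpCost_walk hpos hwalk⟩
  · obtain ⟨j, hj, -, -, -, hlt⟩ := h.exists_visitTime hpos v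
    exact hlt.trans_le (h.t_mono hj)
  · intro u v i j hij hu hv hui hiv
    have hj : (Triple.ofWords k t w hw).t j.succ = t (i + 2) := congrArg (fun a => t (a + 1)) hij
    rw [hj]
    exact h.isShort_of_notMem_tourTimes hpos hu hv hui hiv

end IsPlan

/-! ## The cost of a plan -/

variable {k j : ℕ}

theorem sum_range_blockEnd_succ (hj : j < k) (f : ℕ → ℕ) :
    ∑ m ∈ Finset.range (blockEnd k (j + 1)), f m = ∑ m ∈ Finset.range (blockEnd k j), f m +
      ∑ i ∈ Finset.range (2 ^ (k - (j + 1))), f (blockEnd k j + i) := by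
  rw [blockEnd_succ hj, Finset.sum_range_add]

theorem two_pow_sub (hj : j < k) : 2 ^ (k - j) = 2 * 2 ^ (k - (j + 1)) := by
  rw [← pow_succ']
  congr 1
  lia

/-- The thresholds grow by a factor `3 / 2` where they do not follow the targets, and the sizes of
the blocks decrease by a factor `2`. -/
theorem sum_blocks_threshold_le {t D : ℕ → ℕ} (ht0 : t 0 = 0)
    (ht : ∀ j < k, 2 * t (j + 1) ≤ 3 * t j + 66 * D (j + 1)) (hj : j ≤ k) :
    ∑ i ∈ Finset.range j, 2 ^ (k - (i + 1)) * t (i + 1) + 3 * (2 ^ (k - j) * t j) ≤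
      132 * ∑ i ∈ Finset.range j, 2 ^ (k - (i + 1)) * D (i + 1) := by
  induction j with
  | zero => rw [ht0]; rfl
  | succ j ih =>
    have ih := ih (by lia)
    have hmul := Nat.mul_le_mul_left (2 ^ (k - (j + 1))) (ht j hj)
    rw [two_pow_sub hj] at ih
    rw [Finset.sum_range_succ, Finset.sum_range_succ]
    linarith

theorem sum_le_blocks_threshold {F t : ℕ → ℕ}
    (hF : ∀ j < k, ∀ m ≤ blockEnd k (j + 1), F m ≤ t (min (j + 2) k)) :
    ∑ m ∈ Finset.range (blockEnd k k), F (m + 1) ≤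
      2 * ∑ i ∈ Finset.range k, 2 ^ (k - (i + 1)) * t (i + 1) + t k := by
  have hblocks : ∀ j ≤ k, ∑ m ∈ Finset.range (blockEnd k j), F (m + 1) ≤
      ∑ i ∈ Finset.range j, 2 ^ (k - (i + 1)) * t (min (i + 2) k) := fun j hj => by
    induction j with
    | zero => rw [blockEnd_zero]; rfl
    | succ j ih =>
      rw [sum_range_blockEnd_succ hj (fun m => F (m + 1)), Finset.sum_range_succ]
      refine Nat.add_le_add (ih (by lia)) ((Finset.sum_le_card_nsmul _ _ _ fun i hi =>
        hF j hj _ ?_).trans_eq (by rw [Finset.card_range, smul_eq_mul]))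
      rw [blockEnd_succ hj]
      exact Nat.add_lt_add_left (Finset.mem_range.1 hi) _
  refine (hblocks k le_rfl).trans ?_
  rcases k with _ | k
  · exact Nat.zero_le _
  rw [Finset.sum_range_succ, Finset.sum_range_succ', min_eq_right (by lia), Nat.sub_self,
    pow_zero, one_mul, mul_add, Finset.mul_sum]
  refine Nat.add_le_add_right ((Finset.sum_le_sum fun i hi => ?_).trans (Nat.le_add_right _ _)) _
  have hi := Finset.mem_range.1 hi
  rw [two_pow_sub (j := i + 1) (by lia), min_eq_left (by lia), mul_assoc]

/-- In each block the last point counts with the last value of the block, and the others with at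
least the last value of the preceding block, which is twice as large. -/
theorem sum_blocks_le_of_monotone {a : ℕ → ℕ} (ha : Monotone a) (ha0 : a 0 = 0) :
    ∑ i ∈ Finset.range k, 2 ^ (k - (i + 1)) * a (blockEnd k (i + 1)) ≤
      2 * ∑ m ∈ Finset.range (blockEnd k k), a (m + 1) := by
  have hblocks : ∀ j ≤ k, ∑ i ∈ Finset.range j, 2 ^ (k - i) * a (blockEnd k i) +
      2 * a (blockEnd k j) ≤ 2 * ∑ m ∈ Finset.range (blockEnd k j), a (m + 1) := fun j hj => by
    induction j with
    | zero => rw [blockEnd_zero, ha0]; rfl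
    | succ j ih =>
      have ih := ih (by lia)
      obtain ⟨s, hs⟩ := Nat.exists_eq_add_one.2 (Nat.two_pow_pos (k - (j + 1)))
      have hblock : s * a (blockEnd k j) ≤ ∑ i ∈ Finset.range s, a (blockEnd k j + i + 1) := by
        simpa only [Finset.card_range, smul_eq_mul] using Finset.card_nsmul_le_sum
          (Finset.range s) (fun i => a (blockEnd k j + i + 1)) _ fun i _ => ha (by lia)
      rw [sum_range_blockEnd_succ hj (fun m => a (m + 1)), Finset.sum_range_succ,
        two_pow_sub hj, blockEnd_succ hj, hs, Finset.sum_range_succ, ← add_assoc (blockEnd k j)]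
      linarith
  have hsum := Finset.sum_range_succ (fun i => 2 ^ (k - i) * a (blockEnd k i)) k
  rw [Finset.sum_range_succ', blockEnd_zero, ha0, mul_zero, add_zero, Nat.sub_self, pow_zero,
    one_mul] at hsum
  have hlast := hblocks k le_rfl
  lia

theorem sum_place (π : Equiv.Perm (Fin n)) (f : ℕ → ℕ) :
    ∑ v, f (place π v) = ∑ i ∈ Finset.range n, f (i + 1) := by
  rw [← Fin.sum_univ_eq_sum_range (fun i => f (i + 1)) n]
  exact Equiv.sum_comp π.symm (fun i : Fin n => f (i + 1))

theorem IsStaged.sum_stageOf_le {I : Instance n} {π : Equiv.Perm (Fin n)} {t p : ℕ → ℕ}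
    {tour : ℕ → Prop} (h : IsStaged I π k t p tour)
    (ht : ∀ j < k, 2 * t (j + 1) ≤ 3 * t j + 66 * I.arrival π (blockEnd k (j + 1))) :
    ∑ v, t (stageOf p (place π v)) ≤ 528 * I.latency π := by
  have hend : blockEnd k k = n := by
    have hcard := h.card
    have hadd := blockEnd_add (le_refl k)
    rw [Nat.sub_self, pow_zero] at hadd
    lia
  have hcharge := sum_le_blocks_threshold (k := k) (t := t) (F := fun m => t (stageOf p m))
    fun j hj m hm => h.t_mono <| Nat.sInf_le <| by
      rcases Nat.lt_or_eq_of_le hj with hlt | rfl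
      · rw [min_eq_left hlt]
        exact hm.trans (h.blockEnd_lt_p hlt).le
      · rw [min_eq_right (by lia)]
        exact hm.trans_eq (hend.trans h.p_last.symm)
  have hthreshold := sum_blocks_threshold_le (D := fun j => I.arrival π (blockEnd k j)) h.t_zero ht
    le_rfl
  have harrival := sum_blocks_le_of_monotone (k := k) (I.arrival_mono π) (by rfl)
  have hlatency : I.latency π = ∑ i ∈ Finset.range n, I.arrival π (i + 1) :=
    sum_place π (I.arrival π)
  rw [hlatency, sum_place π (fun m => t (stageOf p m))]
  rw [hend] at hcharge harrival
  lia

/-! ## The guess for a path -/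

variable {g : ℕ}

theorem IsStaging.congr {c : ℕ → ℕ → ℕ} {t t' p : ℕ → ℕ} {tour tour' : ℕ → Prop}
    (h : IsStaging c t k p tour) (ht : ∀ j ≤ k, t' j = t j)
    (htour : ∀ j ≤ k, (tour' j ↔ tour j)) : IsStaging c t' k p tour' := by
  have hbad : ∀ j ≤ k, ∀ m, IsBad c t' p tour' j m ↔ IsBad c t p tour j m := fun j hj m =>
    exists_congr fun i => and_congr_right fun hi => by
      rw [htour (i + 1) (by lia), ht (i + 2) (by lia)]
  refine ⟨h.zero, (htour 0 (Nat.zero_le k)).not.2 h.not_tour_zero, fun j hj hj' => ?_,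
    fun j hj hj' => h.of_not_tour j hj ((htour _ hj).not.1 hj'), fun j hj m hm hlt hlast => ?_⟩
  · rw [hbad _ hj]
    exact h.of_tour j hj ((htour _ hj).1 hj')
  · rw [hbad _ hj]
    exact h.not_bad j hj m hm hlt fun hj' => hlast ((htour _ hj).2 hj')

theorem word_succ_of_pos {c : ℕ → ℕ → ℕ} (h : 0 < word c n g (j + 1)) (h' : 0 < word c n g j) :
    word c n g (j + 1) = word c n g j := by
  rw [word] at h ⊢
  split_ifs at h ⊢
  · rfl
  · exact absurd h (lt_irrefl 0)

theorem word_succ_of_not_pos {c : ℕ → ℕ → ℕ} (h : 0 < tourBit g j) (h' : ¬ 0 < word c n g j) :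
    word c n g (j + 1) = centralWord c n (threshold g (j + 1) / 32) ((n + 1) / 2 ^ j) := by
  rw [word, if_pos h, if_neg h']

section Staged

variable {I : Instance n} {π : Equiv.Perm (Fin n)} {p : ℕ → ℕ} {tour : ℕ → Prop}

theorem IsStaged.isCentral_word (h : IsStaged I π k (threshold g) p tour)
    (hbit : ∀ j < k, (0 < tourBit g j ↔ tour (j + 1))) (hj : j < k) (ht : tour (j + 1))
    (hw : ¬ 0 < word I.cost n g j) :
    0 < word I.cost n g (j + 1) ∧ IsCentral I.cost n (threshold g (j + 1) / 32) (2 ^ (k - j))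
      (word I.cost n g (j + 1) - 1) := by
  obtain ⟨r, hr, hcentral⟩ := h.exists_isCentral hj ht
  rw [word_succ_of_not_pos ((hbit j hj).2 ht) hw, h.card, Nat.pow_div hj.le two_pos]
  exact isCentral_centralWord hr hcentral

theorem IsStaged.word_pos_iff (h : IsStaged I π k (threshold g) p tour)
    (hbit : ∀ j < k, (0 < tourBit g j ↔ tour (j + 1))) (hj : j ≤ k) :
    0 < word I.cost n g j ↔ tour j := by
  rcases j with _ | j
  · exact iff_of_false (lt_irrefl 0) h.staging.not_tour_zero
  by_cases ht : tour (j + 1)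
  · refine iff_of_true ?_ ht
    by_cases hw : 0 < word I.cost n g j
    · rwa [word, if_pos ((hbit j hj).2 ht), if_pos hw]
    · exact (h.isCentral_word hbit hj ht hw).1
  · refine iff_of_false ?_ ht
    rw [word, if_neg ((hbit j hj).not.2 ht)]
    exact lt_irrefl 0

theorem IsStaged.exists_isPlan (h : IsStaged I π k (threshold g) p tour)
    (hbit : ∀ j < k, (0 < tourBit g j ↔ tour (j + 1))) (hn : 0 < n) :
    ∃ r, IsPlan I π k (threshold g) p (word I.cost n g) r := by
  have hpos : ∀ j ≤ k, (0 < word I.cost n g j ↔ tour j) := fun j hj => h.word_pos_iff hbit hj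
  refine ⟨fun j => ⟨word I.cost n g (j + 1) - 1, by have := word_le I.cost n g (j + 1); lia⟩,
    { h with
      staging := h.staging.congr (fun _ _ => rfl) hpos
      word_eq := fun j _ hw => (Nat.sub_add_cancel hw).symm
      root_eq := fun j _ hw hw' => Fin.ext ?_
      central := fun j hj hw hw' => (h.isCentral_word hbit hj ((hpos _ hj).1 hw) hw').2 }⟩
  rcases j with _ | j
  · exact absurd hw' (lt_irrefl 0)
  · exact congrArg (· - 1) (word_succ_of_pos hw hw')

end Staged

namespace Instance

variable (I : Instance n) (π : Equiv.Perm (Fin n))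

theorem arrival_le_reach (hk : n + 1 = 2 ^ k) {m : ℕ} (hm : m ≤ n) :
    I.arrival π m ≤ I.reach k := by
  have hsum : I.arrival π m ≤ m * I.maxCost :=
    (Finset.sum_le_card_nsmul _ _ _ fun j _ => I.c_le_maxCost _ _).trans_eq
      (by rw [Finset.card_range, smul_eq_mul])
  rw [reach, ← hk, mul_comm]
  exact hsum.trans (Nat.mul_le_mul_right _ (by lia))

theorem exists_isPlan (hn : 0 < n) (hk : n + 1 = 2 ^ k) (hpos : ∀ u v, u ≠ v → 0 < I.c u v) :
    ∃ g < I.guessCount k, ∃ p r, IsPlan I π k (threshold g) p (word I.cost n g) r ∧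
      ∀ j < k, 2 * threshold g (j + 1) ≤
        3 * threshold g j + 66 * I.arrival π (blockEnd k (j + 1)) := by
  have hend : ∀ j, blockEnd k j ≤ n := fun j => by
    have := Nat.two_pow_pos (k - j)
    unfold blockEnd
    lia
  have harrival : ∀ j < k, 0 < I.arrival π (blockEnd k (j + 1)) := fun j hj =>
    (Nat.zero_le _).trans_lt <| (I.arrival_lt π hpos hn).trans_le <|
      I.arrival_mono π ((Nat.zero_le _).trans_lt (blockEnd_lt hj))
  let D : ℕ → ℕ := fun j => I.arrival π (blockEnd k j)
  let stages := stage (I.pathDist π) (targetThreshold D) k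
  obtain ⟨g, hg, hthreshold, hbit⟩ := exists_guess_of_targets (k := k) (D := D) I
    (fun j _ => I.arrival_le_reach π hk (hend _)) fun j => (stages (j + 1)).2
  have hstaged : IsStaged I π k (threshold g) (fun j => (stages j).1) (fun j => (stages j).2) :=
    { card := hk
      t_zero := rfl
      t_gap := three_mul_threshold_le g
      arrival_le_succ := fun j hj => by
        rw [hthreshold (j + 1) hj]
        exact le_targetThreshold D j
      staging := (isStaging_stage _ _ k).congr hthreshold fun _ _ => Iff.rfl }
  obtain ⟨r, hplan⟩ := hstaged.exists_isPlan hbit hn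
  refine ⟨g, hg, _, r, hplan, fun j hj => ?_⟩
  rw [hthreshold j hj.le, hthreshold (j + 1) hj]
  exact targetThreshold_le (harrival j hj)

theorem exists_isFeasible_le (hn : 0 < n) (hk : n + 1 = 2 ^ k)
    (hpos : ∀ u v, u ≠ v → 0 < I.c u v) :
    ∃ G ∈ I.triples k, ∃ x z, I.IsFeasible G x z ∧ I.lpCost G x ≤ 528 * (I.latency π : ℝ) := by
  obtain ⟨g, hg, p, r, hplan, hgrowth⟩ := I.exists_isPlan π hn hk hpos
  obtain ⟨x, z, hfeasible, hcost⟩ := hplan.exists_isFeasible hpos hn (word_le I.cost n g)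
  refine ⟨I.decode k g, List.mem_map.2 ⟨g, List.mem_range.2 hg, rfl⟩, x, z, hfeasible,
    hcost.trans_le ?_⟩
  exact_mod_cast hplan.sum_stageOf_le hgrowth

theorem IsNice.pos {I : Instance n} {ε : ℝ} (h : I.IsNice ε) : 0 < n := by
  obtain ⟨hpos, hle⟩ := h.2 .source .target nofun
  rcases n.eq_zero_or_pos with rfl | hn
  · rw [Nat.cast_zero, zero_pow (by decide), mul_zero, zero_div] at hle
    exact absurd (Nat.cast_pos.2 hpos) hle.not_gt
  · exact hn

theorem exists_triples_bound : ∃ C d : ℕ, ∀ (ε : ℝ), 0 < ε → ∀ (n : ℕ) (I : Instance n),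
    I.IsNice ε → ∀ k, n + 1 = 2 ^ k →
      ((latencyProg.steps (I.loopBound k) : ℕ) : ℝ) ≤ C * ((n : ℝ) + 1 / ε + 1) ^ d ∧
      ((I.triples k).length : ℝ) ≤ C * ((n : ℝ) + 1 / ε + 1) ^ d := by
  obtain ⟨C, d, hsteps⟩ := latencyProg.exists_steps_le
  refine ⟨(C + 1) * (8 * 64 ^ 64) ^ (d + 1), 514 * (d + 1), fun ε hε n I hI k hk => ?_⟩
  have hbound := hI.loopBound_le hε hk
  have hlength : (I.triples k).length ≤ I.loopBound k := by
    rw [triples, List.length_map, List.length_range]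
    exact Nat.le_add_left _ _
  have hpoly : ∀ {a : ℕ}, a ≤ (C + 1) * (I.loopBound k + 1) ^ (d + 1) →
      (a : ℝ) ≤ ((C + 1) * (8 * 64 ^ 64) ^ (d + 1) : ℕ) *
        ((n : ℝ) + 1 / ε + 1) ^ (514 * (d + 1)) := fun {a} ha =>
    calc (a : ℝ) ≤ (C + 1) * ((I.loopBound k : ℝ) + 1) ^ (d + 1) := mod_cast ha
      _ ≤ (C + 1) * (8 * 64 ^ 64 * ((n : ℝ) + 1 / ε + 1) ^ 514) ^ (d + 1) := by gcongr
      _ = _ := by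
        rw [mul_pow, ← pow_mul, ← mul_assoc, Nat.cast_mul, Nat.cast_pow, Nat.cast_succ]
        norm_cast
  refine ⟨hpoly ((hsteps _).trans ?_), hpoly (hlength.trans ?_)⟩
  · gcongr <;> lia
  · exact (Nat.le_succ _).trans ((Nat.le_self_pow d.succ_ne_zero _).trans
      (Nat.le_mul_of_pos_left _ C.succ_pos))

end Instance

end DirLat

theorem mainTheorem4_general :
    ∃ (prog : RAM.Prog) (C d : ℕ),
      ∀ (ε : ℝ), 0 < ε → ∀ (n : ℕ) (I : DirLat.Instance n), I.IsNice ε →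
        ∃ (steps : ℕ) (σ : RAM.State) (L : List (DirLat.Triple n)),
          RAM.Exec prog I.input steps σ ∧
          σ.HasOutput (DirLat.encodeTriples L) ∧
          (steps : ℝ) ≤ C * ((n : ℝ) + 1 / ε + 1) ^ d ∧
          (L.length : ℝ) ≤ C * ((n : ℝ) + 1 / ε + 1) ^ d ∧
          (∀ G ∈ L, G.IsValid) ∧
          ∀ π : Equiv.Perm (Fin n),
            ∃ G ∈ L, ∃ (x : DirLat.Site n × ℕ → ℝ) (z : DirLat.TimeEdge n → ℝ),
              I.IsFeasible G x z ∧ I.lpCost G x ≤ 528 * (I.latency π : ℝ) := by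
  obtain ⟨C, d, hbound⟩ := DirLat.Instance.exists_triples_bound
  refine ⟨DirLat.latencyProg, C, d, fun ε hε n I hI => ?_⟩
  obtain ⟨k, hk⟩ := hI.1
  obtain ⟨hsteps, hlength⟩ := hbound ε hε n I hI k hk
  obtain ⟨steps, hle, σ, hexec, hout⟩ := I.runs_latencyProg hk
  refine ⟨steps, σ, I.triples k, hexec, hout, (Nat.cast_le.2 hle).trans hsteps, hlength,
    fun G hG => ?_, fun π => I.exists_isFeasible_le π hI.pos hk fun u v huv => (hI.2 u v huv).1⟩
  obtain ⟨g, -, rfl⟩ := List.mem_map.1 hG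
  exact I.isValid_decode hk g

theorem mainTheorem4 :
    ∃ (prog : RAM.Prog) (C d : ℕ),
      ∀ (ε : ℝ), 0 < ε → ∀ (n : ℕ) (I : DirLat.Instance n), I.IsNice ε →
        ∃ (steps : ℕ) (σ : RAM.State) (L : List (DirLat.Triple n)),
          -- on input `I`, the program halts and outputs the list `L`, in polynomial time
          RAM.Exec prog I.input steps σ ∧
          σ.HasOutput (DirLat.encodeTriples L) ∧
          (steps : ℝ) ≤ C * ((n : ℝ) + 1 / ε + 1) ^ d ∧
          -- the list is polynomial-sized and consists of admissible triples
          (L.length : ℝ) ≤ C * ((n : ℝ) + 1 / ε + 1) ^ d ∧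
          (∀ G ∈ L, G.IsValid) ∧
          -- for one of the triples the linear program has a cheap solution
          ∀ OPT : Equiv.Perm (Fin n), I.IsOptimal OPT →
            ∃ G ∈ L, ∃ (x : DirLat.Site n × ℕ → ℝ) (z : DirLat.TimeEdge n → ℝ),
              I.IsFeasible G x z ∧ I.lpCost G x ≤ 532 * (I.latency OPT : ℝ) := by
  obtain ⟨prog, C, d, h⟩ := mainTheorem4_general
  refine ⟨prog, C, d, fun ε hε n I hI => ?_⟩
  obtain ⟨steps, σ, L, hexec, hout, hsteps, hlength, hvalid, hcheap⟩ := h ε hε n I hI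
  refine ⟨steps, σ, L, hexec, hout, hsteps, hlength, hvalid, fun OPT _ => ?_⟩
  obtain ⟨G, hG, x, z, hx, hcost⟩ := hcheap OPT
  exact ⟨G, hG, x, z, hx, hcost.trans (by gcongr; norm_num)⟩
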